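/- Let $V=\coprod_{n\in\mathbb{Z}}V_{(n)}$ be a vertex operator algebra (over $\mathbb{C}$, in the sense of Frenkel–Lepowsky–Meurman and Frenkel–Huang–Lepowsky). By a discretely $\mathbb{R}$-graded $V$-module we mean an $\mathbb{R}$-graded $V$-module $W=\coprod_{r\in\mathbb{R}}W_{(r)}$ such that $\coprod_{s\le r}W_{(s)}$ is finite-dimensional for every $r\in\mathbb{R}$; $W'=\coprod_{r}W_{(r)}^{*}$ denotes its contragredient module. Let $C_1(W)$ be the span of the elements $u_{-1}w$ with $u\in V_+=\coprod_{n>0}V_{(n)}$ and $w\in W$, and call $W$ $C_1$-cofinite if $\dim W/C_1(W)<\infty$. **Theorem 1.6.** Let $W_0,\dots,W_{p+1}$ be $C_1$-cofinite discretely $\mathbb{R}$-graded $V$-modules and let $w_i\in W_i$ for $i=0,\dots,p+1$. Then there exist positive integers $m_1,\dots,m_p$ and $$a_{k,l}(z_1,\dots,z_p)\in\mathbb{C}[z_1^{\pm1},\dots,z_p^{\pm1},(z_1-z_2)^{-1},(z_1-z_3)^{-1},\dots,(z_{p-1}-z_p)^{-1}],\qquad 1\le k\le m_l,\ 1\le l\le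 p,$$ such that for all discretely $\mathbb{R}$-graded $V$-modules $\tilde W_1,\dots,\tilde W_{p-1}$ and all intertwining operators $\mathcal{Y}_1,\dots,\mathcal{Y}_p$ of types $\binom{W_0'}{W_1\tilde W_1},\binom{\tilde W_1}{W_2\tilde W_2},\dots,\binom{\tilde W_{p-2}}{W_{p-1}\tilde W_{p-1}},\binom{\tilde W_{p-1}}{W_pW_{p+1}}$ respectively (for $p=1$: a single $\mathcal{Y}_1$ of type $\binom{W_0'}{W_1W_2}$), the formal series $$\varphi=\langle w_0,\mathcal{Y}_1(w_1,z_1)\cdots\mathcal{Y}_p(w_p,z_p)w_{p+1}\rangle$$ in (complex) powers of $z_1,\dots,z_p$ satisfies the system $$\frac{\partial^{m_l}\varphi}{\partial z_l^{m_l}}+\sum_{k=1}^{m_l}\iota(a_{k,l})\,\frac{\partial^{m_l-k}\varphi}{\partial z_l^{m_l-k}}=0,\qquad l=1,\dots,p.$$ Here $\partial/\partial z_l$ acts term by term, and $\iota(a)$ is the expansion of $a$ in the region $|z_1|>\cdots>|z_p|>0$, that is, $(z_i-z_j)^{-1}$ with $i<j$ is expanded as $\sum_{n\ge0}z_i^{-1-n}z_j^{n}$;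 the products of $\iota(a_{k,l})$ with the series are well defined, each coefficient being a finite sum. The numbers $m_l$ and the coefficients $a_{k,l}$ depend only on the $W_i$ and $w_i$, not on the modules $\tilde W_q$ or the intertwining operators. -/

import Mathlib

universe u v

/-- A complex vector space `W` with a linear map `u ↦ Y(u, x) = ∑ₙ uₙ x⁻ⁿ⁻¹` from `V` to
`(End W)[[x, x⁻¹]]`; `mode n u w` is `uₙ w`. No axioms are imposed at this stage. -/
structure VertexAction (V : Type u) [AddCommGroup V] [Module ℂ V] where
  carrier : Type v
  [addCommGroup : AddCommGroup carrier]
  [module : Module ℂ carrier]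
  mode : ℤ → V →ₗ[ℂ] carrier →ₗ[ℂ] carrier

attribute [instance] VertexAction.addCommGroup VertexAction.module

/-- The Jacobi identity
`x₀⁻¹ δ((x₁ - x₂)/x₀) Y₃(u, x₁) I(a, x₂) b - x₀⁻¹ δ((x₂ - x₁)/(-x₀)) I(a, x₂) Y₂(u, x₁) b
  = x₂⁻¹ δ((x₁ - x₀)/x₂) I(Y₁(u, x₀) a, x₂) b`,
written out as the equality of the coefficients of `x₀⁻ˡ⁻¹ x₁⁻ᵐ⁻¹ x₂⁻ⁿ⁻¹`. Here
`Yᵢ(u, x) = ∑_{n ∈ ℤ} uₙ x⁻ⁿ⁻¹` and `I(a, x) = ∑ₙ aₙ x⁻ⁿ⁻¹` with `n` running over `K`, which is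
`ℤ` for algebras and modules and `ℂ` for intertwining operators. The sums over `i` are finite
whenever the lower truncation conditions hold. -/
def JacobiIdentity {K : Type*} [Ring K] {V A B C : Type*}
    [AddCommGroup V] [Module ℂ V] [AddCommGroup A] [Module ℂ A]
    [AddCommGroup B] [Module ℂ B] [AddCommGroup C] [Module ℂ C]
    (Y₁ : ℤ → V →ₗ[ℂ] A →ₗ[ℂ] A) (Y₂ : ℤ → V →ₗ[ℂ] B →ₗ[ℂ] B) (Y₃ : ℤ → V →ₗ[ℂ] C →ₗ[ℂ] C)
    (I : K → A →ₗ[ℂ] B →ₗ[ℂ] C) : Prop :=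
  ∀ (u : V) (a : A) (b : B) (l m : ℤ) (n : K),
    ∑ᶠ i : ℕ, ((-1 : ℂ) ^ i * (Ring.choose l i : ℤ)) • Y₃ (m + l - i) u (I (n + i) a b)
      - ∑ᶠ i : ℕ, ((-1 : ℂ) ^ l * (-1 : ℂ) ^ i * (Ring.choose l i : ℤ)) •
          I (n + l - i) a (Y₂ (m + i) u b)
      = ∑ᶠ i : ℕ, ((Ring.choose m i : ℤ) : ℂ) • I (m + n - i) (Y₁ (l + i) u a) b

/-- The relations `[L(m), L(n)] = (m - n) L(m + n) + (m³ - m)/12 δ_{m+n,0} c` of the Virasoro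
algebra with central charge `c`. -/
def VirasoroRelations {W : Type*} [AddCommGroup W] [Module ℂ W] (L : ℤ → W →ₗ[ℂ] W) (c : ℂ) :
    Prop :=
  ∀ (m n : ℤ) (w : W),
    L m (L n w) - L n (L m w) =
      ((m : ℂ) - n) • L (m + n) w + (if m + n = 0 then ((m : ℂ) ^ 3 - m) / 12 * c else 0) • w

/-- A vertex operator algebra structure on the complex vector space `V`. -/
structure VertexOperatorAlgebra (V : Type u) [AddCommGroup V] [Module ℂ V] where
  /-- the homogeneous subspaces `V₍ₙ₎` -/
  grade : ℤ → Submodule ℂ V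
  /-- `mode n u v` is `uₙ v`, where `Y(u, x) = ∑ₙ uₙ x⁻ⁿ⁻¹` -/
  mode : ℤ → V →ₗ[ℂ] V →ₗ[ℂ] V
  vacuum : V
  conformal : V
  centralCharge : ℂ
  isInternal : DirectSum.IsInternal grade
  finiteDimensional_grade : ∀ n, FiniteDimensional ℂ (grade n)
  exists_grade_eq_bot : ∃ N : ℤ, ∀ n < N, grade n = ⊥
  vacuum_mem : vacuum ∈ grade 0
  conformal_mem : conformal ∈ grade 2
  truncation : ∀ u v : V, ∃ N : ℤ, ∀ n ≥ N, mode n u v = 0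
  vacuum_mode : ∀ (n : ℤ) (v : V), mode n vacuum v = if n = -1 then v else 0
  creation : ∀ v : V, mode (-1) v vacuum = v ∧ ∀ n ≥ 0, mode n v vacuum = 0
  jacobi : JacobiIdentity mode mode mode mode
  virasoro : VirasoroRelations (fun n => mode (n + 1) conformal) centralCharge
  L_zero : ∀ (n : ℤ), ∀ v ∈ grade n, mode 1 conformal v = (n : ℂ) • v
  L_neg_one_derivative : ∀ (n : ℤ) (u v : V),
    mode n (mode 0 conformal u) v = -(n : ℂ) • mode (n - 1) u v

/-- A discretely `ℝ`-graded module for the vertex operator algebra `𝒱`: an `ℝ`-graded module such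
that, for every `r`, the subspace spanned by the elements of weight at most `r` is
finite-dimensional. (So the weight spaces are finite-dimensional and the weights are bounded
below.) -/
structure DiscreteModule {V : Type u} [AddCommGroup V] [Module ℂ V]
    (𝒱 : VertexOperatorAlgebra V) extends VertexAction.{u, v} V where
  /-- the homogeneous subspaces `W₍ᵣ₎` -/
  grade : ℝ → Submodule ℂ carrier
  isInternal : DirectSum.IsInternal grade
  discrete : ∀ r : ℝ, FiniteDimensional ℂ (⨆ s : Set.Iic r, grade s : Submodule ℂ carrier)
  truncation : ∀ (u : V) (w : carrier), ∃ N : ℤ, ∀ n ≥ N, mode n u w = 0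
  vacuum_mode : ∀ (n : ℤ) (w : carrier), mode n 𝒱.vacuum w = if n = -1 then w else 0
  jacobi : JacobiIdentity 𝒱.mode mode mode mode
  virasoro : VirasoroRelations (fun n => mode (n + 1) 𝒱.conformal) 𝒱.centralCharge
  L_zero : ∀ (r : ℝ), ∀ w ∈ grade r, mode 1 𝒱.conformal w = (r : ℂ) • w
  L_neg_one_derivative : ∀ (n : ℤ) (u : V) (w : carrier),
    mode n (𝒱.mode 0 𝒱.conformal u) w = -(n : ℂ) • mode (n - 1) u w

section Projections

variable {ι W : Type*} [DecidableEq ι] [AddCommGroup W] [Module ℂ W] {g : ι → Submodule ℂ W}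

/-- The projection of a graded space onto its component of degree `k`. -/
noncomputable def gradeProj (h : DirectSum.IsInternal g) (k : ι) : W →ₗ[ℂ] W :=
  (g k).subtype ∘ₗ DirectSum.component ℂ ι (fun i => g i) k ∘ₗ
    (LinearEquiv.ofBijective (DirectSum.coeLinearMap g) h).symm.toLinearMap

theorem gradeProj_mem (h : DirectSum.IsInternal g) (k : ι) (w : W) : gradeProj h k w ∈ g k := by
  simp [gradeProj]

theorem gradeProj_support (h : DirectSum.IsInternal g) (w : W) :
    (Function.support fun k => gradeProj h k w).Finite := by
  classical
  refine Set.Finite.subset (DFinsupp.support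
    ((LinearEquiv.ofBijective (DirectSum.coeLinearMap g) h).symm w)).finite_toSet ?_
  intro k hk
  simp only [Finset.mem_coe, DFinsupp.mem_support_toFun]
  intro h0
  apply hk
  simp only [gradeProj, LinearMap.comp_apply, LinearEquiv.coe_coe, Submodule.subtype_apply]
  change (((LinearEquiv.ofBijective (DirectSum.coeLinearMap g) h).symm w) k : W) = 0
  rw [h0]
  rfl

theorem gradeProj_eq_zero (h : DirectSum.IsInternal g) {w : W}
    (hw : ∀ k, gradeProj h k w = 0) : w = 0 := by
  have : (LinearEquiv.ofBijective (DirectSum.coeLinearMap g) h).symm w = 0 := by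
    refine DFinsupp.ext fun k => ?_
    exact Subtype.ext (hw k)
  simpa using this

theorem gradeProj_of_mem (h : DirectSum.IsInternal g) {k : ι} {w : W} (hw : w ∈ g k) (j : ι) :
    gradeProj h j w = if j = k then w else 0 := by
  have hs : (LinearEquiv.ofBijective (DirectSum.coeLinearMap g) h).symm w =
      DirectSum.of (fun i => g i) k ⟨w, hw⟩ := by
    rw [LinearEquiv.symm_apply_eq]
    exact (DirectSum.coeLinearMap_of (A := g) k ⟨w, hw⟩).symm
  change (((LinearEquiv.ofBijective (DirectSum.coeLinearMap g) h).symm w) j : W) = _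
  rw [hs, DirectSum.coe_of_apply]
  by_cases hj : j = k
  · subst hj; simp
  · rw [if_neg (fun h' => hj h'.symm), if_neg hj]; rfl

/-- If `T` acts on the component of degree `k` as the scalar `d k`, with `d` injective, then every
eigenvector of `T` with eigenvalue `d k` has degree `k`. -/
theorem mem_of_eigenvector (h : DirectSum.IsInternal g) (T : W →ₗ[ℂ] W) (d : ι → ℂ)
    (hd : Function.Injective d) (hT : ∀ k, ∀ w ∈ g k, T w = d k • w) {k : ι} {w : W}
    (hw : T w = d k • w) : w ∈ g k := by
  have comm : ∀ (j : ι) (x : W), gradeProj h j (T x) = d j • gradeProj h j x := by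
    intro j x
    have hx : x ∈ (⨆ i, g i) := by rw [h.submodule_iSup_eq_top]; trivial
    induction hx using Submodule.iSup_induction' with
    | mem i y hy =>
      rw [hT i y hy, map_smul, gradeProj_of_mem h hy]
      by_cases hj : j = i
      · subst hj; simp
      · simp [hj]
    | zero => simp
    | add y z _ _ hy hz => simp only [map_add, hy, hz, smul_add]
  have : w - gradeProj h k w = 0 := by
    apply gradeProj_eq_zero h
    intro j
    rw [map_sub, gradeProj_of_mem h (gradeProj_mem h k w)]
    by_cases hj : j = k
    · subst hj; simp
    · have h1 := comm j w
      rw [hw, map_smul] at h1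
      have h2 : (d k - d j) • gradeProj h j w = 0 := by rw [sub_smul, h1, sub_self]
      rcases smul_eq_zero.mp h2 with h3 | h3
      · exact absurd (hd (sub_eq_zero.mp h3)).symm hj
      · simp [hj, h3]
  rw [sub_eq_zero.mp this]
  exact gradeProj_mem h k w

end Projections

namespace VertexOperatorAlgebra

variable {V : Type u} [AddCommGroup V] [Module ℂ V] (𝒱 : VertexOperatorAlgebra V)

/-- The Virasoro operator `L(1)` on `V`. -/
def L_one : V →ₗ[ℂ] V := 𝒱.mode 2 𝒱.conformal

/-- The component of weight `k` of an element of `V`. -/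
noncomputable def proj (k : ℤ) : V →ₗ[ℂ] V := gradeProj 𝒱.isInternal k

/-- `V₊`, the sum of the homogeneous subspaces of positive weight. -/
def positivePart : Submodule ℂ V := ⨆ n : Set.Ioi (0 : ℤ), 𝒱.grade n

theorem L_one_mem {k : ℤ} {x : V} (hx : x ∈ 𝒱.grade k) : 𝒱.L_one x ∈ 𝒱.grade (k - 1) := by
  refine mem_of_eigenvector 𝒱.isInternal (𝒱.mode 1 𝒱.conformal) (fun n : ℤ => (n : ℂ))
    Int.cast_injective (fun n w hw => 𝒱.L_zero n w hw) ?_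
  have h := 𝒱.virasoro 0 1 x
  norm_num at h
  rw [𝒱.L_zero k x hx, map_smul] at h
  have h2 : 𝒱.mode 1 𝒱.conformal (𝒱.mode 2 𝒱.conformal x) =
      (k : ℂ) • 𝒱.mode 2 𝒱.conformal x - 𝒱.mode 2 𝒱.conformal x := by
    rw [sub_eq_iff_eq_add] at h
    rw [h]; abel
  simp only [L_one]
  rw [h2]
  push_cast
  rw [sub_smul, one_smul]

theorem L_one_pow_mem {k : ℤ} {x : V} (hx : x ∈ 𝒱.grade k) (j : ℕ) :
    (𝒱.L_one ^ j) x ∈ 𝒱.grade (k - j) := by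
  induction j with
  | zero => simpa using hx
  | succ j ih =>
    rw [pow_succ', Module.End.mul_apply]
    have := 𝒱.L_one_mem ih
    have e : k - ((j + 1 : ℕ) : ℤ) = k - j - 1 := by push_cast; ring
    rwa [e]

theorem L_one_pow_support {k : ℤ} {x : V} (hx : x ∈ 𝒱.grade k) :
    (Function.support fun j : ℕ => (𝒱.L_one ^ j) x).Finite := by
  obtain ⟨N, hN⟩ := 𝒱.exists_grade_eq_bot
  refine Set.Finite.subset (Set.finite_Iic (k - N).toNat) ?_
  intro j hj
  by_contra hlt
  apply hj
  have hm := 𝒱.L_one_pow_mem hx j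
  rw [hN (k - j) (by simp only [Set.mem_Iic] at hlt; omega)] at hm
  exact hm

end VertexOperatorAlgebra

namespace DiscreteModule

variable {V : Type u} [AddCommGroup V] [Module ℂ V] {𝒱 : VertexOperatorAlgebra V}

/-- `C₁(W)`, the span of the elements `u₋₁ w` with `u ∈ V₊` and `w ∈ W`. -/
def C₁ (W : DiscreteModule.{u, v} 𝒱) : Submodule ℂ W.carrier :=
  Submodule.span ℂ {x | ∃ u ∈ 𝒱.positivePart, ∃ w : W.carrier, x = W.mode (-1) u w}

/-- `W` is `C₁`-cofinite: `dim W / C₁(W) < ∞`. -/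
def IsC₁Cofinite (W : DiscreteModule.{u, v} 𝒱) : Prop :=
  FiniteDimensional ℂ (W.carrier ⧸ W.C₁)

theorem mode_mem (W : DiscreteModule.{u, v} 𝒱) {k : ℤ} {x : V} (hx : x ∈ 𝒱.grade k) {r : ℝ}
    {w : W.carrier} (hw : w ∈ W.grade r) (n : ℤ) :
    W.mode n x w ∈ W.grade (r + k - n - 1) := by
  refine mem_of_eigenvector W.isInternal (W.mode 1 𝒱.conformal) (fun s : ℝ => (s : ℂ))
    Complex.ofReal_injective (fun s y hy => W.L_zero s y hy) ?_
  have h := W.jacobi 𝒱.conformal x w 0 1 n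
  have e1 : ∑ᶠ i : ℕ, ((-1 : ℂ) ^ i * (Ring.choose (0 : ℤ) i : ℤ)) •
      W.mode (1 + 0 - i) 𝒱.conformal (W.mode (n + i) x w) =
      W.mode 1 𝒱.conformal (W.mode n x w) := by
    rw [finsum_eq_single _ 0]
    · simp
    · intro i hi
      simp [Ring.choose_zero_ite, hi]
  have e2 : ∑ᶠ i : ℕ, ((-1 : ℂ) ^ (0 : ℤ) * (-1 : ℂ) ^ i * (Ring.choose (0 : ℤ) i : ℤ)) •
      W.mode (n + (0 : ℤ) - i) x (W.mode (1 + i) 𝒱.conformal w) =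
      W.mode n x (W.mode 1 𝒱.conformal w) := by
    rw [finsum_eq_single _ 0]
    · simp
    · intro i hi
      simp [Ring.choose_zero_ite, hi]
  have e3 : ∑ᶠ i : ℕ, ((Ring.choose (1 : ℤ) i : ℤ) : ℂ) •
      W.mode ((1 : ℤ) + n - i) (𝒱.mode (0 + i) 𝒱.conformal x) w =
      W.mode (n + 1) (𝒱.mode 0 𝒱.conformal x) w + W.mode n (𝒱.mode 1 𝒱.conformal x) w := by
    rw [finsum_eq_sum_of_support_subset (s := Finset.range 2)]
    · simp [Finset.sum_range_succ, add_comm]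
    · intro i hi
      by_contra hlt
      apply hi
      have h2 : 1 < i := by simpa using hlt
      have : Ring.choose (1 : ℤ) i = 0 := by
        have := Ring.choose_natCast (R := ℤ) 1 i
        rw [Nat.choose_eq_zero_of_lt h2] at this
        simpa using this
      simp [this]
  simp only [Int.cast_id] at h
  rw [e1, e2, e3, W.L_zero r w hw, 𝒱.L_zero k x hx, W.L_neg_one_derivative, map_smul, map_smul,
    LinearMap.smul_apply, sub_eq_iff_eq_add] at h
  rw [h]
  push_cast
  simp only [add_sub_cancel_right]
  module

/-- The adjoint `uₙ^*` on `W` of the operator `uₙ` on the contragredient module. It is defined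
through `Y'(u, x) = Y(e^{xL(1)} (-x⁻²)^{L(0)} u, x⁻¹)^*`: for `u` of weight `k`,
`uₙ^* = (-1)^k ∑_{j ≥ 0} (L(1)^j u)_{2k-n-j-2} / j!`. -/
noncomputable def adjointMode (W : DiscreteModule.{u, v} 𝒱) (n : ℤ) :
    V →ₗ[ℂ] W.carrier →ₗ[ℂ] W.carrier where
  toFun x := ∑ᶠ k : ℤ, ∑ᶠ j : ℕ, ((-1 : ℂ) ^ k / (j.factorial : ℂ)) •
    W.mode (2 * k - n - j - 2) ((𝒱.L_one ^ j) (𝒱.proj k x))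
  map_add' x y := by
    have hj : ∀ (k : ℤ) (z : V), (Function.support fun j : ℕ =>
        ((-1 : ℂ) ^ k / (j.factorial : ℂ)) •
          W.mode (2 * k - n - j - 2) ((𝒱.L_one ^ j) (𝒱.proj k z))).Finite := by
      intro k z
      refine (𝒱.L_one_pow_support (gradeProj_mem 𝒱.isInternal k z)).subset ?_
      intro j hj h0
      apply hj
      have h0' : (𝒱.L_one ^ j) (𝒱.proj k z) = 0 := h0
      simp [h0']
    have hk : ∀ z : V, (Function.support fun k : ℤ => ∑ᶠ j : ℕ,
        ((-1 : ℂ) ^ k / (j.factorial : ℂ)) •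
          W.mode (2 * k - n - j - 2) ((𝒱.L_one ^ j) (𝒱.proj k z))).Finite := by
      intro z
      refine (gradeProj_support 𝒱.isInternal z).subset ?_
      intro k hk h0
      apply hk
      have h0' : 𝒱.proj k z = 0 := h0
      simp [h0']
    rw [← finsum_add_distrib (hk x) (hk y)]
    refine finsum_congr fun k => ?_
    rw [← finsum_add_distrib (hj k x) (hj k y)]
    refine finsum_congr fun j => ?_
    simp only [map_add, smul_add]
  map_smul' c x := by
    rw [RingHom.id_apply, smul_finsum]
    refine finsum_congr fun k => ?_
    rw [smul_finsum]
    refine finsum_congr fun j => ?_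
    simp only [map_smul]
    rw [smul_comm]

/-- The graded dual `∐ᵣ W₍ᵣ₎^*` of `W`: the functionals vanishing on all but finitely many
`W₍ᵣ₎`. -/
def gradedDual (W : DiscreteModule.{u, v} 𝒱) : Submodule ℂ (Module.Dual ℂ W.carrier) where
  carrier := {f | {r : ℝ | ∃ w ∈ W.grade r, f w ≠ 0}.Finite}
  zero_mem' := by simp
  add_mem' {f g} hf hg := by
    refine (Set.Finite.union hf hg).subset ?_
    rintro r ⟨w, hw, hne⟩
    by_cases h : f w = 0
    · right
      refine ⟨w, hw, fun h' => hne ?_⟩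
      simp [h, h']
    · exact Or.inl ⟨w, hw, h⟩
  smul_mem' c f hf := by
    refine Set.Finite.subset hf ?_
    rintro r ⟨w, hw, hne⟩
    refine ⟨w, hw, fun h' => hne ?_⟩
    simp [h']

theorem comp_adjointMode_mem (W : DiscreteModule.{u, v} 𝒱) (n : ℤ) (x : V)
    {f : Module.Dual ℂ W.carrier} (hf : f ∈ W.gradedDual) :
    f ∘ₗ W.adjointMode n x ∈ W.gradedDual := by
  have hf' : {r : ℝ | ∃ w ∈ W.grade r, f w ≠ 0}.Finite := hf
  have hfin : (⋃ k ∈ (Function.support fun k => 𝒱.proj k x),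
      (fun s : ℝ => s + k - n - 1) '' {r : ℝ | ∃ w ∈ W.grade r, f w ≠ 0}).Finite :=
    Set.Finite.biUnion (gradeProj_support 𝒱.isInternal x) fun k _ => hf'.image _
  refine hfin.subset ?_
  rintro r ⟨w, hw, hne⟩
  by_contra hr
  apply hne
  have key : ∀ (k : ℤ) (j : ℕ),
      f (W.mode (2 * k - n - j - 2) ((𝒱.L_one ^ j) (𝒱.proj k x)) w) = 0 := by
    intro k j
    by_cases h0 : 𝒱.proj k x = 0
    · simp [h0]
    by_contra hne'
    apply hr
    refine Set.mem_biUnion (x := k) h0 ⟨r - k + n + 1, ⟨_, ?_, hne'⟩, by ring⟩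
    have hm := W.mode_mem (𝒱.L_one_pow_mem (gradeProj_mem 𝒱.isInternal k x) j) hw
      (2 * k - n - j - 2)
    have e : r + ((k - j : ℤ) : ℝ) - ((2 * k - n - j - 2 : ℤ) : ℝ) - 1 = r - k + n + 1 := by
      push_cast; ring
    rw [e] at hm
    exact hm
  have vanish : ∀ (T : Submodule ℂ (W.carrier →ₗ[ℂ] W.carrier)),
      (∀ t : W.carrier →ₗ[ℂ] W.carrier, t ∈ T ↔ f (t w) = 0) → W.adjointMode n x ∈ T := by
    intro T hT
    change (∑ᶠ k : ℤ, ∑ᶠ j : ℕ, ((-1 : ℂ) ^ k / (j.factorial : ℂ)) •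
      W.mode (2 * k - n - j - 2) ((𝒱.L_one ^ j) (𝒱.proj k x))) ∈ T
    refine finsum_induction (· ∈ T) T.zero_mem (fun _ _ => T.add_mem) fun k => ?_
    refine finsum_induction (· ∈ T) T.zero_mem (fun _ _ => T.add_mem) fun j => ?_
    exact T.smul_mem _ ((hT _).2 (key k j))
  let E : (W.carrier →ₗ[ℂ] W.carrier) →ₗ[ℂ] ℂ := f ∘ₗ LinearMap.applyₗ w
  exact vanish (LinearMap.ker E) fun t => by simp [E]

/-- The contragredient `W'`: the graded dual of `W`, on which `uₙ` acts as the transpose of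
`uₙ^*`. -/
noncomputable def contragredient (W : DiscreteModule.{u, v} 𝒱) : VertexAction.{u, v} V where
  carrier := W.gradedDual
  mode n :=
    { toFun := fun x =>
        { toFun := fun f => ⟨f.1 ∘ₗ W.adjointMode n x, W.comp_adjointMode_mem n x f.2⟩
          map_add' := fun _ _ => rfl
          map_smul' := fun _ _ => rfl }
      map_add' := fun x y => by
        ext f w
        simp
      map_smul' := fun c x => by
        ext f w
        simp }

end DiscreteModule

/-- An intertwining operator `𝓨(a, x) = ∑_{n ∈ ℂ} aₙ x⁻ⁿ⁻¹` of type `C` over `A B` (that is, of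
type `(C ; A B)`): `𝓨(a, x) b` is the series with coefficients `mode n a b = aₙ b` in `C`. -/
structure IntertwiningOperator {V : Type u} [AddCommGroup V] [Module ℂ V]
    (𝒱 : VertexOperatorAlgebra V) (A B C : VertexAction.{u, v} V) where
  mode : ℂ → A.carrier →ₗ[ℂ] B.carrier →ₗ[ℂ] C.carrier
  truncation : ∀ (n : ℂ) (a : A.carrier) (b : B.carrier),
    ∃ N : ℕ, ∀ m : ℕ, N ≤ m → mode (n + m) a b = 0
  jacobi : JacobiIdentity A.mode B.mode C.mode mode
  /-- `d/dx 𝓨(a, x) = 𝓨(L(-1) a, x)` -/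
  L_neg_one_derivative : ∀ (n : ℂ) (a : A.carrier) (b : B.carrier),
    mode n (A.mode 0 𝒱.conformal a) b = -n • mode (n - 1) a b

/-- `IntertwiningProduct 𝒱 B p W A` is the type of sequences `𝓨₁, …, 𝓨ₚ` of composable
intertwining operators, of types `A` over `W₁, M₁`, then `M₁` over `W₂, M₂`, and so on up to
`Mₚ₋₁` over `Wₚ, B`, with arbitrary discretely `ℝ`-graded modules `M₁, …, Mₚ₋₁`. -/
inductive IntertwiningProduct {V : Type u} [AddCommGroup V] [Module ℂ V]
    (𝒱 : VertexOperatorAlgebra V) (B : DiscreteModule.{u, v} 𝒱) :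
    (p : ℕ) → (Fin p → DiscreteModule.{u, v} 𝒱) → VertexAction.{u, v} V → Type (max u (v + 1))
  | nil (W : Fin 0 → DiscreteModule.{u, v} 𝒱) : IntertwiningProduct 𝒱 B 0 W B.toVertexAction
  | cons {p : ℕ} (W : Fin (p + 1) → DiscreteModule.{u, v} 𝒱) {A : VertexAction.{u, v} V}
      (M : DiscreteModule.{u, v} 𝒱)
      (Y : IntertwiningOperator 𝒱 (W 0).toVertexAction M.toVertexAction A)
      (rest : IntertwiningProduct 𝒱 B p (fun i => W i.succ) M.toVertexAction) :
      IntertwiningProduct 𝒱 B (p + 1) W A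

/-- The coefficient `(w₁)_{n₁} ⋯ (wₚ)_{nₚ} b` of `x₁^{-n₁-1} ⋯ xₚ^{-nₚ-1}` in
`𝓨₁(w₁, x₁) ⋯ 𝓨ₚ(wₚ, xₚ) b`. -/
def IntertwiningProduct.mode {V : Type u} [AddCommGroup V] [Module ℂ V]
    {𝒱 : VertexOperatorAlgebra V} {B : DiscreteModule.{u, v} 𝒱} :
    {p : ℕ} → {W : Fin p → DiscreteModule.{u, v} 𝒱} → {A : VertexAction.{u, v} V} →
    IntertwiningProduct 𝒱 B p W A → (Fin p → ℂ) → (∀ i, (W i).carrier) → B.carrier → A.carrier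
  | _, _, _, .nil _, _, _, b => b
  | _, _, _, .cons _ _ Y rest, n, w, b =>
    Y.mode (n 0) (w 0) (rest.mode (fun i => n i.succ) (fun i => w i.succ) b)

/-- Formal series `∑ₑ φ(e) z₁^{e₁} ⋯ zₚ^{eₚ}` with complex exponents. -/
abbrev FormalSeries (p : ℕ) : Type := (Fin p → ℂ) → ℂ

/-- The series `⟨w₀, 𝓨₁(w₁, z₁) ⋯ 𝓨ₚ(wₚ, zₚ) b⟩`, where `𝓨₁` takes values in the
contragredient of the module containing `w₀`. -/
noncomputable def matrixElement {V : Type u} [AddCommGroup V] [Module ℂ V]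
    {𝒱 : VertexOperatorAlgebra V} {W₀ B : DiscreteModule.{u, v} 𝒱} {p : ℕ}
    {W : Fin p → DiscreteModule.{u, v} 𝒱}
    (Y : IntertwiningProduct 𝒱 B p W W₀.contragredient)
    (w₀ : W₀.carrier) (w : ∀ i, (W i).carrier) (b : B.carrier) : FormalSeries p :=
  fun e =>
    let f : W₀.gradedDual := Y.mode (fun i => -e i - 1) w b
    (f : Module.Dual ℂ W₀.carrier) w₀

/-- The formal partial derivative `∂/∂z_l`. -/
noncomputable def FormalSeries.pderiv {p : ℕ} (l : Fin p) (φ : FormalSeries p) : FormalSeries p :=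
  fun e => (e l + 1) * φ (e + Pi.single l 1)

open MvPolynomial in
/-- The multiplicative set generated by the `zᵢ` and the `zᵢ - zⱼ`, `i < j`. -/
noncomputable def singularDenominators (p : ℕ) : Submonoid (MvPolynomial (Fin p) ℂ) :=
  Submonoid.closure
    ({f | ∃ i, f = X i} ∪ {f | ∃ i j, i < j ∧ f = X i - X j})

/-- The ring `ℂ[z₁^{±1}, …, zₚ^{±1}, (z₁ - z₂)⁻¹, (z₁ - z₃)⁻¹, …, (zₚ₋₁ - zₚ)⁻¹]`. -/
abbrev CoefficientRing (p : ℕ) : Type := Localization (singularDenominators p)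

/-- Exponent vectors of Laurent monomials in `z₁, …, zₚ`, ordered lexicographically starting from
the last coordinate. Thus `zⱼ / zᵢ` has positive exponent for `i < j`, as is appropriate for
expansions in the region `|z₁| > ⋯ > |zₚ| > 0`. -/
abbrev LaurentExponent (p : ℕ) : Type := Lex ((Fin p)ᵒᵈ → ℤ)

/-- The variable `zᵢ` as a Hahn series. -/
noncomputable def laurentVariable {p : ℕ} (i : Fin p) : HahnSeries (LaurentExponent p) ℂ :=
  HahnSeries.single (toLex (Pi.single (OrderDual.toDual i) 1)) 1

theorem laurentVariable_injective {p : ℕ} :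
    Function.Injective (laurentVariable : Fin p → HahnSeries (LaurentExponent p) ℂ) := by
  intro i j h
  by_contra hne
  have h2 := congrArg (fun f => HahnSeries.coeff f
    (toLex (Pi.single (OrderDual.toDual i) 1) : LaurentExponent p)) h
  have hne' : (toLex (Pi.single (OrderDual.toDual i) 1) : LaurentExponent p) ≠
      toLex (Pi.single (OrderDual.toDual j) 1) := by
    intro h3
    have h4 := congrFun (toLex.injective h3) (OrderDual.toDual i)
    rw [Pi.single_eq_same, Pi.single_eq_of_ne (fun h5 => hne (OrderDual.toDual.injective h5))] at h4
    exact one_ne_zero h4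
  simp only [laurentVariable, HahnSeries.coeff_single_same, HahnSeries.coeff_single_of_ne hne']
    at h2
  exact one_ne_zero h2

theorem isUnit_aeval_laurentVariable {p : ℕ} (f : singularDenominators p) :
    IsUnit ((MvPolynomial.aeval laurentVariable :
      MvPolynomial (Fin p) ℂ →ₐ[ℂ] HahnSeries (LaurentExponent p) ℂ).toRingHom f) := by
  obtain ⟨f, hf⟩ := f
  induction hf using Submonoid.closure_induction with
  | mem x hx =>
    rw [isUnit_iff_ne_zero]
    rcases hx with ⟨i, rfl⟩ | ⟨i, j, hij, rfl⟩
    · simp [laurentVariable]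
    · simpa [sub_eq_zero] using fun h => hij.ne (laurentVariable_injective h)
  | one => simp
  | mul x y _ _ hx hy =>
    have := hx.mul hy
    simpa using this

/-- The ring homomorphism `ι` expanding an element of the coefficient ring in the region
`|z₁| > ⋯ > |zₚ| > 0`, where `(zᵢ - zⱼ)⁻¹ = ∑_{k ≥ 0} zᵢ^{-1-k} zⱼ^k` for `i < j`. -/
noncomputable def laurentExpansion (p : ℕ) :
    CoefficientRing p →+* HahnSeries (LaurentExponent p) ℂ :=
  IsLocalization.lift (M := singularDenominators p)
    (g := (MvPolynomial.aeval laurentVariable :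
      MvPolynomial (Fin p) ℂ →ₐ[ℂ] HahnSeries (LaurentExponent p) ℂ).toRingHom)
    isUnit_aeval_laurentVariable

/-- The coefficient of `z₁^{k₁} ⋯ zₚ^{kₚ}` in the expansion of `a` in the region
`|z₁| > ⋯ > |zₚ| > 0`. -/
noncomputable def expansionCoeff {p : ℕ} (a : CoefficientRing p) (k : Fin p → ℤ) : ℂ :=
  (laurentExpansion p a).coeff (toLex fun i => k (OrderDual.ofDual i))

namespace FormalSeries

variable {p : ℕ}

/-- The product of the expansion of `a` with `φ` is a well-defined formal series: each of its
coefficients is a finite sum. -/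
def Multipliable (a : CoefficientRing p) (φ : FormalSeries p) : Prop :=
  ∀ e : Fin p → ℂ,
    (Function.support fun k : Fin p → ℤ => expansionCoeff a k * φ fun i => e i - k i).Finite

/-- The product of the expansion of `a` in the region `|z₁| > ⋯ > |zₚ| > 0` with `φ`. -/
noncomputable def expansionMul (a : CoefficientRing p) (φ : FormalSeries p) : FormalSeries p :=
  fun e => ∑ᶠ k : Fin p → ℤ, expansionCoeff a k * φ fun i => e i - k i

/-- `φ` satisfies the expansion, in the region `|z₁| > ⋯ > |zₚ| > 0`, of the equation
`∂ᵐφ/∂z_lᵐ + ∑_{k=1}^m aₖ(z₁, …, zₚ) ∂ᵐ⁻ᵏφ/∂z_lᵐ⁻ᵏ = 0`; in particular all the products in it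
are well defined. -/
def SatisfiesExpansion (l : Fin p) (m : ℕ) (a : ℕ → CoefficientRing p) (φ : FormalSeries p) :
    Prop :=
  (∀ k ∈ Finset.Icc 1 m, Multipliable (a k) ((pderiv l)^[m - k] φ)) ∧
    (pderiv l)^[m] φ + ∑ k ∈ Finset.Icc 1 m, expansionMul (a k) ((pderiv l)^[m - k] φ) = 0

end FormalSeries

open Filter

/-! Let R be the image of the coefficient ring under expansion in |z₁| > ⋯ > |zₚ| > 0. All matrix
elements are treated at once: for fixed W₀, …, Wₚ₊₁ the vectors are sent to the function assigning
to each sequence of intertwining operators, and each base exponent, the part of the matrix element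
with exponents in the integral coset of that base point. The supports of these parts are well
ordered, so they are Hahn series, which R multiplies. The result is a multilinear map `correlator`
into an R-module of functions. A linear relation over R between its values holds for all
intermediate modules and all intertwining operators simultaneously; this is why the coefficients of
the system do not depend on them.

The Jacobi identity lets u₋₁ be removed from any of the p + 2 vectors. If u has weight k > 0, the
correlator with u₋₁wᵢ in place of wᵢ is an R-combination of correlators whose total weight is lower
by at least 1 (`correlator_mode_neg_one_mem_weightSpan`). The coefficients that occur are powers of
the zₗ and expansions of (zₗ - zⱼ)^{-s-1}, which lie in R (`mixedSeries_mem`). By C₁-cofiniteness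
every homogeneous vector of large weight is a combination of such u₋₁w. Descent on the total weight,
which is bounded below, places all correlators in the R-module spanned by those of vectors of weight
at most some N (`exists_correlator_mem_boundedSpan`). That module is finitely generated because the
spaces of bounded weight are finite-dimensional (`boundedSpan_fg`).

Since R is Noetherian, so is this module. The correlators with L(-1)ⁿwₗ in place of wₗ, n = 0, 1, 2,
…, therefore satisfy a relation with leading coefficient 1. As L(-1) on wₗ is ∂/∂zₗ on the matrix
element (`pderiv_fullMatrixElement`), this relation is the desired equation. -/

theorem Ring.choose_neg_one_int (i : ℕ) : Ring.choose (-1 : ℤ) i = (-1) ^ i := by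
  induction i with
  | zero => simp
  | succ i ih =>
    have h := Ring.choose_succ_succ (-1 : ℤ) i
    rw [neg_add_cancel, Ring.choose_zero_succ, ih] at h
    rw [pow_succ]
    linarith

/-! ### Two special cases of the Jacobi identity. -/

namespace JacobiIdentity

variable {V A B C : Type*} [AddCommGroup V] [Module ℂ V] [AddCommGroup A] [Module ℂ A]
  [AddCommGroup B] [Module ℂ B] [AddCommGroup C] [Module ℂ C]
  {Y₁ : ℤ → V →ₗ[ℂ] A →ₗ[ℂ] A} {Y₂ : ℤ → V →ₗ[ℂ] B →ₗ[ℂ] B} {Y₃ : ℤ → V →ₗ[ℂ] C →ₗ[ℂ] C}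
  {I : ℂ → A →ₗ[ℂ] B →ₗ[ℂ] C}

/-- The commutator formula, the coefficient of `x₀⁻¹` in the Jacobi identity. -/
theorem commutator (h : JacobiIdentity Y₁ Y₂ Y₃ I) (u : V) (a : A) (b : B) (m : ℤ) (n : ℂ) {S : ℕ}
    (hS : ∀ s : ℕ, S ≤ s → Y₁ s u a = 0) :
    Y₃ m u (I n a b) = I n a (Y₂ m u b) + ∑ s ∈ Finset.range S,
      ((Ring.choose m s : ℤ) : ℂ) • I (n + ((m - s : ℤ) : ℂ)) (Y₁ s u a) b := by
  have h0 := h u a b 0 m n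
  have e1 : ∑ᶠ i : ℕ, ((-1 : ℂ) ^ i * (Ring.choose (0 : ℤ) i : ℤ)) •
      Y₃ (m + 0 - i) u (I (n + i) a b) = Y₃ m u (I n a b) := by
    rw [finsum_eq_single _ 0]
    · simp
    · intro i hi
      simp [Ring.choose_zero_ite, hi]
  have e2 : ∑ᶠ i : ℕ, ((-1 : ℂ) ^ (0 : ℤ) * (-1 : ℂ) ^ i * (Ring.choose (0 : ℤ) i : ℤ)) •
      I (n + (0 : ℤ) - i) a (Y₂ (m + i) u b) = I n a (Y₂ m u b) := by
    rw [finsum_eq_single _ 0]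
    · simp
    · intro i hi
      simp [Ring.choose_zero_ite, hi]
  rw [e1, e2, finsum_eq_sum_of_support_subset (s := Finset.range S), sub_eq_iff_eq_add'] at h0
  · rw [h0]
    congr 1
    refine Finset.sum_congr rfl fun s _ => ?_
    congr 3
    · congr 1
      push_cast
      ring
    · simp
  · intro s hs
    by_contra hlt
    apply hs
    have hs' : S ≤ s := by simpa using hlt
    simp [hS s hs']

/-- The case `u₋₁` of the iterate formula. -/
theorem iterate_neg_one (h : JacobiIdentity Y₁ Y₂ Y₃ I) (u : V) (a : A) (b : B) (n : ℂ) {N : ℕ}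
    (ha : ∀ i : ℕ, N ≤ i → I (n + i) a b = 0) (hb : ∀ i : ℕ, N ≤ i → Y₂ i u b = 0) :
    I n (Y₁ (-1) u a) b = ∑ i ∈ Finset.range N, Y₃ (-1 - i) u (I (n + i) a b) +
      ∑ i ∈ Finset.range N, I (n + ((-1 - i : ℤ) : ℂ)) a (Y₂ i u b) := by
  -- For l = -1, m = 0 the right side of the Jacobi identity has a single term, and the binomials
  -- (-1 choose i) = (-1)ⁱ cancel the signs on the left.
  have h0 := h u a b (-1) 0 n
  have e3 : ∑ᶠ i : ℕ, ((Ring.choose (0 : ℤ) i : ℤ) : ℂ) •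
      I ((0 : ℤ) + n - i) (Y₁ (-1 + i) u a) b = I n (Y₁ (-1) u a) b := by
    rw [finsum_eq_single _ 0]
    · simp
    · intro i hi
      simp [Ring.choose_zero_ite, hi]
  have hsq : ∀ i : ℕ, (-1 : ℂ) ^ i * (-1 : ℂ) ^ i = 1 := fun i => by
    rw [← mul_pow]; simp
  rw [e3, finsum_eq_sum_of_support_subset (s := Finset.range N),
    finsum_eq_sum_of_support_subset (s := Finset.range N)] at h0
  · rw [← h0, sub_eq_add_neg, ← Finset.sum_neg_distrib]
    congr 1
    · refine Finset.sum_congr rfl fun i _ => ?_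
      rw [Ring.choose_neg_one_int]
      push_cast
      rw [hsq, one_smul]
    · refine Finset.sum_congr rfl fun i _ => ?_
      rw [Ring.choose_neg_one_int]
      push_cast
      rw [mul_assoc, hsq]
      simp only [zpow_neg, zpow_one, mul_one, zero_add]
      norm_num [sub_eq_add_neg, add_assoc]
  · intro i hi
    by_contra hlt
    apply hi
    have hs' : N ≤ i := by simpa using hlt
    simp [hb i hs']
  · intro i hi
    by_contra hlt
    apply hi
    have hs' : N ≤ i := by simpa using hlt
    simp [ha i hs']

end JacobiIdentity

/-! ### Bookkeeping of exponents. -/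

/-- Translation of complex exponents by integral ones. -/
def exponentShift {p : ℕ} (n : Fin p → ℂ) (a : Fin p → ℤ) : Fin p → ℂ := fun t => n t + a t

section exponentShift

variable {p : ℕ} (n : Fin (p + 1) → ℂ)

theorem exponentShift_apply {p : ℕ} (n : Fin p → ℂ) (a : Fin p → ℤ) (t : Fin p) :
    exponentShift n a t = n t + a t := rfl

theorem exponentShift_apply_zero (a : Fin (p + 1) → ℤ) :
    exponentShift n a 0 = n 0 + a 0 := rfl

theorem exponentShift_tail (a : Fin (p + 1) → ℤ) :
    (fun i => exponentShift n a (Fin.succ i)) =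
      exponentShift (fun i => n i.succ) (fun i => a i.succ) := rfl

theorem exponentShift_zero {p : ℕ} (n : Fin p → ℂ) : exponentShift n 0 = n := by
  ext; simp [exponentShift]

end exponentShift

theorem Pi.single_zero_tail {p : ℕ} (c : ℤ) :
    (fun i : Fin p => (Pi.single 0 c : Fin (p + 1) → ℤ) i.succ) = 0 := by
  ext i; simp

theorem Pi.single_succ_tail {p : ℕ} (j : Fin p) (c : ℤ) :
    (fun i : Fin p => (Pi.single j.succ c : Fin (p + 1) → ℤ) i.succ) = Pi.single j c := by
  ext i; simp [Pi.single_apply]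

theorem Pi.single_zero_add_single_succ_tail {p : ℕ} (j : Fin p) (c d : ℤ) :
    (fun i : Fin p => (Pi.single 0 c + Pi.single j.succ d : Fin (p + 1) → ℤ) i.succ) =
      Pi.single j d := by
  ext i; simp [Pi.single_apply]

theorem Function.update_zero_tail {p : ℕ} {β : Fin (p + 1) → Type*} (w : ∀ i, β i) (x : β 0) :
    (fun i : Fin p => Function.update w 0 x i.succ) = fun i : Fin p => w i.succ := by
  ext i; simp

theorem Function.update_succ_tail {p : ℕ} {β : Fin (p + 1) → Type*} (w : ∀ i, β i) (j : Fin p)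
    (x : β j.succ) : (fun i : Fin p => Function.update w j.succ x i.succ) =
      Function.update (fun i => w i.succ) j x :=
  Function.update_comp_eq_of_injective' w (Fin.succ_injective p) j x

/-- The coefficients of `(zₗ - zⱼ)^{-s-1}`, expanded in the region `|z₁| > ⋯ > |zₚ|`; see
`mixedExponent` for the corresponding monomials. -/
def mixedCoeff {p : ℕ} (l j : Fin p) (s i : ℕ) : ℤ :=
  if j < l then -Ring.choose (-1 - i : ℤ) s else if l < j then Ring.choose (i : ℤ) s else 0

/-- The exponents of the monomials occurring in `(zₗ - zⱼ)^{-s-1}`, expanded in the region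
`|z₁| > ⋯ > |zₚ|`. -/
def mixedExponent {p : ℕ} (l j : Fin p) (s i : ℕ) : Fin p → ℤ :=
  if j < l then Pi.single l (i : ℤ) + Pi.single j (-1 - i - s : ℤ)
  else Pi.single l (-1 - i : ℤ) + Pi.single j (i - s : ℤ)

theorem mixedExponent_succ_succ_zero {p : ℕ} (l j : Fin p) (s i : ℕ) :
    mixedExponent l.succ j.succ s i 0 = 0 := by
  unfold mixedExponent
  split_ifs <;> simp [(Fin.succ_ne_zero _).symm]

theorem mixedExponent_succ_succ_tail {p : ℕ} (l j : Fin p) (s i : ℕ) :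
    (fun t : Fin p => mixedExponent l.succ j.succ s i t.succ) = mixedExponent l j s i := by
  unfold mixedExponent
  simp only [Fin.succ_lt_succ_iff]
  split_ifs <;> ext t <;> simp [Pi.single_apply]

theorem mixedCoeff_succ_succ {p : ℕ} (l j : Fin p) (s i : ℕ) :
    mixedCoeff l.succ j.succ s i = mixedCoeff l j s i := by
  simp [mixedCoeff]

/-! ### Commutator and iterate formulas for products of intertwining operators. -/

namespace IntertwiningProduct

variable {V : Type u} [AddCommGroup V] [Module ℂ V] {𝒱 : VertexOperatorAlgebra V}
  {B : DiscreteModule.{u, v} 𝒱}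

theorem mode_cons {p : ℕ} (W : Fin (p + 1) → DiscreteModule.{u, v} 𝒱) {A : VertexAction.{u, v} V}
    (M : DiscreteModule.{u, v} 𝒱)
    (Y : IntertwiningOperator 𝒱 (W 0).toVertexAction M.toVertexAction A)
    (rest : IntertwiningProduct 𝒱 B p (fun i => W i.succ) M.toVertexAction)
    (n : Fin (p + 1) → ℂ) (w : ∀ i, (W i).carrier) (b : B.carrier) :
    (cons W M Y rest).mode n w b =
      Y.mode (n 0) (w 0) (rest.mode (fun i => n i.succ) (fun i => w i.succ) b) := rfl

variable {p : ℕ} {W : Fin p → DiscreteModule.{u, v} 𝒱} {A : VertexAction.{u, v} V}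

/-- The product of intertwining operators, as a linear function of the rightmost vector. -/
def modeₗ : {p : ℕ} → {W : Fin p → DiscreteModule.{u, v} 𝒱} → {A : VertexAction.{u, v} V} →
    IntertwiningProduct 𝒱 B p W A → (Fin p → ℂ) → (∀ i, (W i).carrier) → B.carrier →ₗ[ℂ] A.carrier
  | _, _, _, .nil _, _, _ => LinearMap.id
  | _, _, _, .cons _ _ Y rest, n, w =>
    Y.mode (n 0) (w 0) ∘ₗ rest.modeₗ (fun i => n i.succ) (fun i => w i.succ)

theorem modeₗ_apply (Y : IntertwiningProduct 𝒱 B p W A) (n : Fin p → ℂ)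
    (w : ∀ i, (W i).carrier) (b : B.carrier) : Y.modeₗ n w b = Y.mode n w b := by
  induction Y with
  | nil => rfl
  | cons W M Y rest ih => rw [mode_cons, ← ih]; rfl

theorem mode_update_add (Y : IntertwiningProduct 𝒱 B p W A) (n : Fin p → ℂ)
    (w : ∀ i, (W i).carrier) (b : B.carrier) (j : Fin p) (x y : (W j).carrier) :
    Y.mode n (Function.update w j (x + y)) b =
      Y.mode n (Function.update w j x) b + Y.mode n (Function.update w j y) b := by
  induction Y with
  | nil => exact j.elim0
  | cons W M Y rest ih =>
    induction j using Fin.cases with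
    | zero => simp [mode_cons]
    | succ j =>
      simp only [mode_cons, Function.update_succ_tail, ih, map_add,
        Function.update_of_ne (Fin.succ_ne_zero j).symm]

theorem mode_update_smul (Y : IntertwiningProduct 𝒱 B p W A) (n : Fin p → ℂ)
    (w : ∀ i, (W i).carrier) (b : B.carrier) (j : Fin p) (c : ℂ) (x : (W j).carrier) :
    Y.mode n (Function.update w j (c • x)) b = c • Y.mode n (Function.update w j x) b := by
  induction Y with
  | nil => exact j.elim0
  | cons W M Y rest ih =>
    induction j using Fin.cases with
    | zero => simp [mode_cons]
    | succ j =>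
      simp only [mode_cons, Function.update_succ_tail, ih, map_smul,
        Function.update_of_ne (Fin.succ_ne_zero j).symm]

theorem mode_L_neg_one (Y : IntertwiningProduct 𝒱 B p W A) (n : Fin p → ℂ)
    (w : ∀ i, (W i).carrier) (b : B.carrier) (j : Fin p) (x : (W j).carrier) :
    Y.mode n (Function.update w j ((W j).mode 0 𝒱.conformal x)) b =
      -n j • Y.mode (exponentShift n (Pi.single j (-1))) (Function.update w j x) b := by
  induction Y with
  | nil => exact j.elim0
  | cons W M Y rest ih =>
    induction j using Fin.cases with
    | zero =>
      simp only [mode_cons, Function.update_self, exponentShift_tail, Pi.single_zero_tail,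
        exponentShift_zero, Function.update_zero_tail, Y.L_neg_one_derivative,
        exponentShift_apply_zero,
        Pi.single_eq_same, Int.cast_neg, Int.cast_one, sub_eq_add_neg]
    | succ j =>
      simp only [mode_cons, Function.update_succ_tail, ih, map_smul, exponentShift_tail,
        Function.update_of_ne (Fin.succ_ne_zero j).symm, Pi.single_succ_tail,
        exponentShift_apply_zero,
        Pi.single_eq_of_ne (Fin.succ_ne_zero j).symm, Int.cast_zero, add_zero]

/-- Moving `uₘ` from the left of a product of intertwining operators to its right. -/
theorem mode_commutator (Y : IntertwiningProduct 𝒱 B p W A) (n : Fin p → ℂ)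
    (w : ∀ i, (W i).carrier) (b : B.carrier) (u : V) (m : ℤ) {S : ℕ}
    (hS : ∀ j, ∀ s : ℕ, S ≤ s → (W j).mode s u (w j) = 0) :
    A.mode m u (Y.mode n w b) = Y.mode n w (B.mode m u b) + ∑ j, ∑ s ∈ Finset.range S,
      ((Ring.choose m s : ℤ) : ℂ) • Y.mode (exponentShift n (Pi.single j (m - s)))
        (Function.update w j ((W j).mode s u (w j))) b := by
  induction Y with
  | nil => simp [mode]
  | cons W M Y rest ih =>
    rw [mode_cons, Y.jacobi.commutator u _ _ m _ (hS 0), ih _ _ fun j => hS j.succ,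
      Fin.sum_univ_succ]
    simp only [mode_cons, Function.update_succ_tail, map_smul, exponentShift_tail, map_add, map_sum,
        Function.update_of_ne (Fin.succ_ne_zero _).symm, Pi.single_succ_tail,
        exponentShift_apply_zero,
        Pi.single_eq_of_ne (Fin.succ_ne_zero _).symm, Int.cast_zero, add_zero,
        Function.update_self, Pi.single_zero_tail,
        exponentShift_zero, Function.update_zero_tail, Pi.single_eq_same]
    abel

/-- The expression of a product of intertwining operators with `u₋₁ wₗ` in the `l`-th place through
products with `u` acting on the other vectors. -/
theorem mode_iterate (Y : IntertwiningProduct 𝒱 B p W A) (n : Fin p → ℂ)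
    (w : ∀ i, (W i).carrier) (b : B.carrier) (u : V) (l : Fin p) {S : ℕ}
    (hS : ∀ j, ∀ s : ℕ, S ≤ s → (W j).mode s u (w j) = 0) :
    ∀ᶠ N : ℕ in atTop, Y.mode n (Function.update w l ((W l).mode (-1) u (w l))) b =
      ∑ i ∈ Finset.range N,
        A.mode (-1 - i) u (Y.mode (exponentShift n (Pi.single l (i : ℤ))) w b) +
      ∑ i ∈ Finset.range N,
        Y.mode (exponentShift n (Pi.single l (-1 - i : ℤ))) w (B.mode i u b) +
      ∑ j, ∑ s ∈ Finset.range S, ∑ i ∈ Finset.range N, (mixedCoeff l j s i : ℂ) •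
        Y.mode (exponentShift n (mixedExponent l j s i))
          (Function.update w j ((W j).mode s u (w j))) b := by
  induction Y with
  | nil => exact l.elim0
  | cons W M Y rest ih =>
    induction l using Fin.cases with
    | zero =>
      -- The truncation bounds depend on the mode indices and on the operators, so only a statement
      -- for all large N is available.
      obtain ⟨N₁, hN₁⟩ := Y.truncation (n 0) (w 0)
        (rest.mode (fun i => n i.succ) (fun i => w i.succ) b)
      obtain ⟨N₂, hN₂⟩ := M.truncation u (rest.mode (fun i => n i.succ) (fun i => w i.succ) b)
      filter_upwards [eventually_ge_atTop N₁, eventually_ge_atTop N₂.toNat] with N h₁ h₂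
      simp only [mode_cons, Function.update_self, Function.update_zero_tail]
      rw [Y.jacobi.iterate_neg_one u (w 0) _ (n 0) (fun i hi => hN₁ i (h₁.trans hi))
        (fun i hi => hN₂ i (by omega)), add_assoc]
      congr 1
      · refine Finset.sum_congr rfl fun i _ => ?_
        simp only [exponentShift_tail, Pi.single_zero_tail, exponentShift_zero,
            exponentShift_apply_zero, Pi.single_eq_same, Int.cast_natCast]
      · rw [Fin.sum_univ_succ]
        simp only [mixedCoeff, mixedExponent, lt_irrefl, if_false, Int.cast_zero, zero_smul,
          Finset.sum_const_zero, zero_add, Fin.not_lt_zero, Fin.succ_pos, if_true]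
        -- The iterate formula leaves uᵢ, i ≥ 0, just to the right of the first operator. Moving it
        -- to the far right yields commutators with coefficients (i choose s), which are those of
        -- the expansion of (zₗ - zⱼ)^{-s-1} for l < j.
        simp only [rest.mode_commutator _ _ b u _ fun j => hS j.succ, map_add,
          Finset.sum_add_distrib]
        congr 1
        · refine Finset.sum_congr rfl fun i _ => ?_
          simp only [exponentShift_tail, Pi.single_zero_tail, exponentShift_zero,
            exponentShift_apply_zero, Pi.single_eq_same]
        · simp only [map_sum]
          rw [Finset.sum_comm]
          refine Finset.sum_congr rfl fun j _ => ?_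
          rw [Finset.sum_comm]
          refine Finset.sum_congr rfl fun s _ => ?_
          refine Finset.sum_congr rfl fun i _ => ?_
          rw [map_smul, exponentShift_tail]
          rw [Pi.single_zero_add_single_succ_tail]
          simp [exponentShift_apply_zero, Function.update_succ_tail,
            Function.update_of_ne (Fin.succ_ne_zero j).symm]
    | succ l =>
      filter_upwards [ih (fun i => n i.succ) (fun i => w i.succ) l fun j => hS j.succ] with N hN
      simp only [mode_cons, Function.update_succ_tail,
        Function.update_of_ne (Fin.succ_ne_zero _).symm]
      rw [hN, Fin.sum_univ_succ]
      simp only [map_add, map_sum]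
      rw [add_add_add_comm, ← add_assoc (_ + _)]
      congr 1
      · congr 1
        · rw [Finset.sum_comm, ← Finset.sum_add_distrib]
          refine Finset.sum_congr rfl fun i _ => ?_
          -- By induction u₋₁₋ᵢ stands to the right of the first operator. Moving it to the left
          -- produces commutator terms with coefficients (-1-i choose s); the mixed terms for j = 0
          -- are exactly their negatives.
          rw [Y.jacobi.commutator u _ _ _ _ (hS 0), add_assoc, ← Finset.sum_add_distrib,
            Finset.sum_eq_zero, add_zero]
          · simp [exponentShift_tail, Pi.single_succ_tail, exponentShift_apply_zero]
          · intro s _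
            simp only [mixedCoeff, mixedExponent, Fin.succ_pos, if_true, exponentShift_tail,
              add_comm (Pi.single l.succ _), Pi.single_zero_add_single_succ_tail,
              Function.update_zero_tail, Function.update_self, exponentShift_apply_zero]
            simp [neg_smul, Pi.single_succ_tail]
        · refine Finset.sum_congr rfl fun i _ => ?_
          simp [exponentShift_tail, Pi.single_succ_tail, exponentShift_apply_zero]
      · refine Finset.sum_congr rfl fun j _ => ?_
        refine Finset.sum_congr rfl fun s _ => ?_
        refine Finset.sum_congr rfl fun i _ => ?_
        rw [map_smul, exponentShift_tail, mixedExponent_succ_succ_tail, mixedCoeff_succ_succ]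
        simp [exponentShift_apply_zero, mixedExponent_succ_succ_zero, Function.update_succ_tail,
          Function.update_of_ne (Fin.succ_ne_zero j).symm]

end IntertwiningProduct

/-! ### Hahn series with a strictly increasing sequence of exponents. -/

namespace HahnSeries

variable {Γ R : Type*}

/-- The series `∑ᵢ cᵢ X^{gᵢ}` with strictly increasing exponents `gᵢ`, as a summable family. -/
noncomputable def monomialFamily [LinearOrder Γ] [AddCommMonoid R] {g : ℕ → Γ} (hg : StrictMono g)
    (c : ℕ → R) : SummableFamily Γ R ℕ where
  toFun i := single (g i) (c i)
  isPWO_iUnion_support' := by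
    have h : (Set.range g).IsPWO := by
      rw [← Set.image_univ]
      exact (Set.IsWF.isPWO (Set.IsWF.of_wellFoundedLT _)).image_of_monotone hg.monotone
    refine h.mono (Set.iUnion_subset fun i => ?_)
    exact (support_single_subset).trans (by simp)
  finite_co_support' x := by
    refine Set.Subsingleton.finite fun i hi j hj => ?_
    have key : ∀ t, (single (g t) (c t)).coeff x ≠ 0 → x = g t := fun t ht => by
      by_contra hne
      exact ht (coeff_single_of_ne hne)
    exact hg.injective ((key i hi).symm.trans (key j hj))

open Classical in
/-- The series `∑ᵢ cᵢ X^{gᵢ}`, for strictly increasing exponents `gᵢ`. -/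
noncomputable def monomialSum [LinearOrder Γ] [AddCommMonoid R] (g : ℕ → Γ) (c : ℕ → R) :
    HahnSeries Γ R :=
  -- The default value allows `mixedSeries` to be formed for l = j as well, where the exponents are
  -- constant and the coefficients vanish anyway.
  if hg : StrictMono g then (monomialFamily hg c).hsum else 0

theorem monomialSum_eq [LinearOrder Γ] [AddCommMonoid R] {g : ℕ → Γ} (hg : StrictMono g)
    (c : ℕ → R) : monomialSum g c = (monomialFamily hg c).hsum := dif_pos hg

theorem monomialSum_succ [LinearOrder Γ] [AddCommMonoid R] {g : ℕ → Γ} (hg : StrictMono g)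
    (c : ℕ → R) : monomialSum g c = single (g 0) (c 0) +
      monomialSum (fun i => g (i + 1)) fun i => c (i + 1) := by
  have hg' : StrictMono fun i => g (i + 1) := fun _ _ h => hg (Nat.succ_lt_succ h)
  rw [monomialSum_eq hg, monomialSum_eq hg']
  ext x
  rw [coeff_add, SummableFamily.coeff_hsum, SummableFamily.coeff_hsum]
  have hf := (monomialFamily hg c).finite_co_support x
  obtain ⟨N, hN⟩ := (show (Function.support fun i => ((monomialFamily hg c) i).coeff x).Finite
    from hf).bddAbove
  rw [finsum_eq_sum_of_support_subset (s := Finset.range (N + 1)),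
    finsum_eq_sum_of_support_subset (s := Finset.range N), Finset.sum_range_succ', add_comm]
  · rfl
  · intro i hi
    have : i + 1 ≤ N := hN hi
    simp only [Finset.coe_range, Set.mem_Iio]
    omega
  · intro i hi
    have : i ≤ N := hN hi
    simp only [Finset.coe_range, Set.mem_Iio]
    omega

theorem monomialSum_sub [LinearOrder Γ] [AddCommGroup R] (g : ℕ → Γ) (c d : ℕ → R) :
    monomialSum g c - monomialSum g d = monomialSum g fun i => c i - d i := by
  by_cases hg : StrictMono g
  · simp only [monomialSum_eq hg]
    ext x
    rw [coeff_sub, SummableFamily.coeff_hsum, SummableFamily.coeff_hsum, SummableFamily.coeff_hsum,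
      ← finsum_sub_distrib ((monomialFamily hg c).finite_co_support x)
        ((monomialFamily hg d).finite_co_support x)]
    refine finsum_congr fun i => ?_
    change (single (g i) (c i)).coeff x - (single (g i) (d i)).coeff x =
      (single (g i) (c i - d i)).coeff x
    simp only [coeff_single]
    split_ifs <;> simp
  · simp [monomialSum, hg]

section

variable [LinearOrder Γ] [AddCommGroup Γ] [IsOrderedAddMonoid Γ] [CommRing R]

theorem single_mul_monomialSum (a : Γ) {g : ℕ → Γ} (hg : StrictMono g) (c : ℕ → R) :
    single a 1 * monomialSum g c = monomialSum (fun i => a + g i) c := by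
  have hg' : StrictMono fun i => a + g i := fun _ _ h => by simpa using hg h
  rw [monomialSum_eq hg, monomialSum_eq hg', ← SummableFamily.hsum_smul]
  congr 1
  ext1 i
  rw [SummableFamily.smul_apply]
  exact single_mul_single.trans (by rw [one_mul]; rfl)

/-- Only finitely many members of a summable family contribute to a given coefficient. The form "for
all large N" allows one truncation to serve several such products and `mode_iterate` together. -/
theorem coeff_monomialSum_mul {g : ℕ → Γ} (hg : StrictMono g) (c : ℕ → R)
    (f : HahnSeries Γ R) (x : Γ) : ∀ᶠ N : ℕ in atTop,
      (monomialSum g c * f).coeff x = ∑ i ∈ Finset.range N, c i * f.coeff (x - g i) := by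
  rw [monomialSum_eq hg, mul_comm, ← SummableFamily.hsum_smul]
  have hf := (f • monomialFamily hg c).finite_co_support x
  obtain ⟨M, hM⟩ := (show (Function.support fun i =>
    ((f • monomialFamily hg c) i).coeff x).Finite from hf).bddAbove
  filter_upwards [eventually_gt_atTop M] with N hN
  rw [SummableFamily.coeff_hsum, finsum_eq_sum_of_support_subset (s := Finset.range N)]
  · refine Finset.sum_congr rfl fun i _ => ?_
    rw [SummableFamily.smul_apply]
    change (f * single (g i) (c i)).coeff x = _
    rw [mul_comm, coeff_single_mul]
  · intro i hi
    simpa using (show i ≤ M from hM hi).trans_lt hN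

end

end HahnSeries

/-! ### Expansions of (zₗ - zⱼ)^{-s-1} and the image of the coefficient ring. -/

/-- The exponent of the monomial `z₁^{a₁} ⋯ zₚ^{aₚ}`. -/
def laurentExponent {p : ℕ} : (Fin p → ℤ) →+ LaurentExponent p where
  toFun a := toLex fun i => a (OrderDual.ofDual i)
  map_zero' := rfl
  map_add' _ _ := rfl

section LaurentExponent

variable {p : ℕ}

theorem laurentExponent_lt {a b : Fin p → ℤ} (i : Fin p) (h : ∀ j, i < j → a j = b j)
    (hi : a i < b i) : laurentExponent a < laurentExponent b :=
  ⟨OrderDual.toDual i, fun j hj => h (OrderDual.ofDual j) hj, hi⟩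

theorem laurentVariable_eq_single (i : Fin p) :
    laurentVariable i = HahnSeries.single (laurentExponent (Pi.single i 1)) 1 := by
  unfold laurentVariable
  congr 2

/-- In either branch the exponent of the variable with the larger index, which the order compares
first, increases with i. -/
theorem mixedExponent_strictMono {l j : Fin p} (hlj : l ≠ j) (s : ℕ) :
    StrictMono fun i => laurentExponent (mixedExponent l j s i) := by
  intro i i' hi
  simp only [mixedExponent]
  split_ifs with h
  · refine laurentExponent_lt l (fun t ht => ?_) ?_
    · simp [ht.ne', (h.trans ht).ne']
    · simpa [h.ne', hlj] using hi
  · have h' : l < j := lt_of_le_of_ne (not_lt.1 h) hlj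
    refine laurentExponent_lt j (fun t ht => ?_) ?_
    · simp [ht.ne', (h'.trans ht).ne']
    · simpa [h'.ne'] using hi

theorem mixedExponent_succ_add_left {l j : Fin p} (s i : ℕ) :
    Pi.single j 1 + mixedExponent l j (s + 1) i = mixedExponent l j s i := by
  unfold mixedExponent
  split_ifs <;>
  · rw [add_left_comm, ← Pi.single_add]
    congr 2
    push_cast
    ring

theorem mixedExponent_succ_add_right {l j : Fin p} (h : j < l) (s i : ℕ) :
    Pi.single l 1 + mixedExponent l j (s + 1) i = mixedExponent l j s (i + 1) := by
  unfold mixedExponent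
  rw [if_pos h, if_pos h, ← add_assoc, ← Pi.single_add]
  congr 2 <;> push_cast <;> ring

theorem mixedExponent_succ_add_right' {l j : Fin p} (h : l < j) (s i : ℕ) :
    Pi.single l 1 + mixedExponent l j (s + 1) (i + 1) = mixedExponent l j s i := by
  unfold mixedExponent
  rw [if_neg h.not_gt, if_neg h.not_gt, ← add_assoc, ← Pi.single_add]
  congr 2 <;> push_cast <;> ring

/-- The series `(zₗ - zⱼ)^{-s-1}`, expanded in the region `|z₁| > ⋯ > |zₚ|`; see
`mixedSeries_eq`. -/
noncomputable def mixedSeries (l j : Fin p) (s : ℕ) : HahnSeries (LaurentExponent p) ℂ :=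
  HahnSeries.monomialSum (fun i => laurentExponent (mixedExponent l j s i))
    fun i => (mixedCoeff l j s i : ℂ)

/-- This is Pascal's rule: multiplication by zⱼ keeps the summation index, multiplication by zₗ
shifts it by one, and the difference of neighbouring binomials with lower entry s + 1 is the
binomial with lower entry s. -/
theorem mixedSeries_succ_mul {l j : Fin p} (hlj : l ≠ j) (s : ℕ) :
    (laurentVariable l - laurentVariable j) * mixedSeries l j (s + 1) = mixedSeries l j s := by
  have hg := mixedExponent_strictMono hlj
  rw [sub_mul, mixedSeries, laurentVariable_eq_single, laurentVariable_eq_single,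
    HahnSeries.single_mul_monomialSum _ (hg _), HahnSeries.single_mul_monomialSum _ (hg _)]
  simp only [← map_add, mixedExponent_succ_add_left]
  rcases lt_or_gt_of_ne hlj with h | h
  · have hg' : StrictMono fun i => laurentExponent (Pi.single l 1 + mixedExponent l j (s + 1) i) :=
      fun i i' hi => by simpa only [map_add, add_lt_add_iff_left] using hg _ hi
    rw [HahnSeries.monomialSum_succ hg']
    · have h0 : mixedCoeff l j (s + 1) 0 = 0 := by
        simp [mixedCoeff, h, h.not_gt, Ring.choose_zero_succ]
      simp only [mixedExponent_succ_add_right' h]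
      rw [h0, Int.cast_zero, map_zero, zero_add, HahnSeries.monomialSum_sub, mixedSeries]
      congr 1
      ext i
      have := Ring.choose_succ_succ (i : ℤ) s
      simp only [mixedCoeff, h, h.not_gt, if_true, if_false]
      push_cast
      rw [this]
      push_cast
      ring
  · simp only [mixedExponent_succ_add_right h]
    rw [HahnSeries.monomialSum_succ (hg s), mixedSeries, HahnSeries.monomialSum_succ (hg s),
      ← sub_sub, sub_right_comm, HahnSeries.monomialSum_sub, sub_eq_add_neg, add_comm,
      ← HahnSeries.single_neg]
    congr 1
    · congr 1
      simp [mixedCoeff, h, Ring.choose_neg_one_int, pow_succ]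
    · congr 1
      ext i
      have := Ring.choose_succ_succ (-1 - (i + 1) : ℤ) s
      rw [show (-1 - (i + 1) + 1 : ℤ) = -1 - i by ring] at this
      simp only [mixedCoeff, h, if_true]
      push_cast
      rw [this]
      push_cast
      ring

/-- The geometric series: the two products differ by a shift of the index, and everything but one
constant term cancels. -/
theorem mixedSeries_zero_mul {l j : Fin p} (hlj : l ≠ j) :
    (laurentVariable l - laurentVariable j) * mixedSeries l j 0 = 1 := by
  have hg := mixedExponent_strictMono hlj
  rw [sub_mul, mixedSeries, laurentVariable_eq_single, laurentVariable_eq_single,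
    HahnSeries.single_mul_monomialSum _ (hg _), HahnSeries.single_mul_monomialSum _ (hg _)]
  simp only [← map_add]
  rcases lt_or_gt_of_ne hlj with h | h
  · have hg' : StrictMono fun i => laurentExponent (Pi.single l 1 + mixedExponent l j 0 i) :=
      fun i i' hi => by simpa only [map_add, add_lt_add_iff_left] using hg _ hi
    rw [HahnSeries.monomialSum_succ hg']
    · have e : ∀ i, Pi.single l 1 + mixedExponent l j 0 (i + 1) =
          Pi.single j 1 + mixedExponent l j 0 i := fun i => by
        simp only [mixedExponent, h.not_gt, if_false]
        rw [← add_assoc, ← Pi.single_add, add_left_comm, ← Pi.single_add]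
        congr 2 <;> push_cast <;> ring
      simp only [e]
      have e0 : Pi.single l 1 + mixedExponent l j 0 0 = 0 := by
        simp [mixedExponent, h.not_gt, ← Pi.single_add]
      have hc : ∀ i, mixedCoeff l j 0 i = 1 := fun i => by simp [mixedCoeff, h, h.not_gt]
      simp only [hc, e0, map_zero]
      rw [add_sub_cancel_right]
      simp
  · have hg' : StrictMono fun i => laurentExponent (Pi.single j 1 + mixedExponent l j 0 i) :=
      fun i i' hi => by simpa only [map_add, add_lt_add_iff_left] using hg _ hi
    rw [HahnSeries.monomialSum_succ hg']
    · have e : ∀ i, Pi.single j 1 + mixedExponent l j 0 (i + 1) =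
          Pi.single l 1 + mixedExponent l j 0 i := fun i => by
        simp only [mixedExponent, h, if_true]
        rw [add_left_comm, ← Pi.single_add, ← add_assoc, ← Pi.single_add]
        congr 2 <;> push_cast <;> ring
      simp only [e]
      have e0 : Pi.single j 1 + mixedExponent l j 0 0 = 0 := by
        simp [mixedExponent, h, ← Pi.single_add]
      have hc : ∀ i, mixedCoeff l j 0 i = -1 := fun i => by simp [mixedCoeff, h]
      simp only [hc, e0, map_zero]
      rw [sub_add_cancel_right]
      simp

/-- Identifies the series produced by commutators with expansions of rational functions; inverses
are taken in the field of Hahn series. -/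
theorem mixedSeries_eq {l j : Fin p} (hlj : l ≠ j) (s : ℕ) :
    mixedSeries l j s = (laurentVariable l - laurentVariable j)⁻¹ ^ (s + 1) := by
  have h0 : laurentVariable l - laurentVariable j ≠ 0 :=
    sub_ne_zero.2 fun h => hlj (laurentVariable_injective h)
  induction s with
  | zero => rw [zero_add, pow_one, eq_inv_of_mul_eq_one_right (mixedSeries_zero_mul hlj)]
  | succ s ih =>
    apply mul_left_cancel₀ h0
    rw [mixedSeries_succ_mul hlj, ih, pow_succ' _ (s + 1), mul_inv_cancel_left₀ h0]

theorem laurentVariable_mem_range (i : Fin p) : laurentVariable i ∈ (laurentExpansion p).range :=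
  ⟨algebraMap _ _ (MvPolynomial.X i : MvPolynomial (Fin p) ℂ), by simp [laurentExpansion]⟩

theorem inv_mem_range_laurentExpansion {f : MvPolynomial (Fin p) ℂ}
    (hf : f ∈ singularDenominators p) :
    (MvPolynomial.aeval laurentVariable f : HahnSeries (LaurentExponent p) ℂ)⁻¹ ∈
      (laurentExpansion p).range := by
  refine ⟨IsLocalization.mk' (CoefficientRing p) 1 ⟨f, hf⟩, ?_⟩
  apply eq_inv_of_mul_eq_one_right
  have h := congrArg (laurentExpansion p)
    (IsLocalization.mk'_spec' (CoefficientRing p) 1 (⟨f, hf⟩ : singularDenominators p))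
  rw [map_mul, map_one, map_one] at h
  simpa [laurentExpansion] using h

theorem single_mem_range (c : ℂ) :
    HahnSeries.single 0 c ∈ (laurentExpansion p).range :=
  ⟨algebraMap _ _ (MvPolynomial.C c : MvPolynomial (Fin p) ℂ), by
    simp [laurentExpansion, HahnSeries.algebraMap_apply]⟩

theorem laurentVariable_zpow_mem_range (i : Fin p) (m : ℤ) :
    laurentVariable i ^ m ∈ (laurentExpansion p).range := by
  have h : (laurentVariable i)⁻¹ ∈ (laurentExpansion p).range := by
    have := inv_mem_range_laurentExpansion
      (f := MvPolynomial.X i) (Submonoid.subset_closure (Or.inl ⟨i, rfl⟩))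
    simpa using this
  cases m with
  | ofNat m => simpa using pow_mem (laurentVariable_mem_range i) m
  | negSucc m =>
    rw [zpow_negSucc, ← inv_pow]
    exact pow_mem h _

theorem mixedSeries_mem_range {l j : Fin p} (hlj : l ≠ j) (s : ℕ) :
    mixedSeries l j s ∈ (laurentExpansion p).range := by
  rw [mixedSeries_eq hlj]
  refine pow_mem ?_ _
  have key : ∀ i i' : Fin p, i < i' →
      (laurentVariable i - laurentVariable i')⁻¹ ∈ (laurentExpansion p).range := fun i i' h => by
    have := inv_mem_range_laurentExpansion (f := MvPolynomial.X i - MvPolynomial.X i')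
      (Submonoid.subset_closure (Or.inr ⟨i, i', h, rfl⟩))
    simpa using this
  rcases lt_or_gt_of_ne hlj with h | h
  · exact key _ _ h
  -- The denominators contain only zᵢ - zⱼ with i < j; the opposite order costs a sign.
  · have e : (laurentVariable l - laurentVariable j)⁻¹ =
        -(laurentVariable j - laurentVariable l)⁻¹ := by
      have h0 := inv_neg (a := laurentVariable j - laurentVariable l)
      exact (congrArg _ (neg_sub _ _).symm).trans h0
    rw [e]
    exact neg_mem (key _ _ h)

theorem laurentVariable_zpow (i : Fin p) (m : ℤ) :
    laurentVariable i ^ m = HahnSeries.single (laurentExponent (Pi.single i m)) 1 := by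
  have h : ∀ m : ℕ, laurentVariable i ^ m =
      HahnSeries.single (laurentExponent (Pi.single i (m : ℤ))) 1 := fun m => by
    rw [laurentVariable_eq_single, HahnSeries.single_pow, one_pow, ← map_nsmul, ← Pi.single_smul]
    simp
  cases m with
  | ofNat m => simpa using h m
  | negSucc m =>
    rw [zpow_negSucc, h, HahnSeries.inv_single, inv_one, ← map_neg, ← Pi.single_neg]
    rfl

/-- Polynomial rings in finitely many variables over a field are Noetherian, and the property passes
to localizations and to homomorphic images. -/
instance isNoetherianRing_range_laurentExpansion : IsNoetherianRing (laurentExpansion p).range :=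
  haveI : IsNoetherianRing (CoefficientRing p) :=
    IsLocalization.isNoetherianRing (singularDenominators p) _ inferInstance
  isNoetherianRing_range _

end LaurentExponent

/-! ### Well-ordered supports of products of intertwining operators. -/

namespace IntertwiningProduct

variable {V : Type u} [AddCommGroup V] [Module ℂ V] {𝒱 : VertexOperatorAlgebra V}
  {B : DiscreteModule.{u, v} 𝒱}
  {p : ℕ} {W : Fin p → DiscreteModule.{u, v} 𝒱} {A : VertexAction.{u, v} V}

/-- The order compares z₁ last, so it is a lexicographic product of the order on the exponents of
z₂, …, zₚ and that on the exponent of z₁. The former range over a well-founded set by induction;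
once they are fixed, lower truncation of the first operator bounds the exponent of z₁ below. -/
theorem isPWO_support (Y : IntertwiningProduct 𝒱 B p W A) (n : Fin p → ℂ)
    (w : ∀ i, (W i).carrier) (b : B.carrier) :
    {x : LaurentExponent p |
      Y.mode (exponentShift n fun i => -ofLex x (OrderDual.toDual i)) w b ≠ 0}.IsPWO := by
  rw [Set.isPWO_iff_isWF]
  induction Y with
  | nil =>
    have : Subsingleton (LaurentExponent 0) :=
      ⟨fun _ _ => funext fun i => (OrderDual.ofDual i).elim0⟩
    exact (Set.subsingleton_of_subsingleton.finite).isWF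
  | @cons p W A M Y rest ih =>
    let t : LaurentExponent (p + 1) → LaurentExponent p :=
      fun x => toLex fun i => ofLex x (OrderDual.toDual (OrderDual.ofDual i).succ)
    let hd : LaurentExponent (p + 1) → ℤ := fun x => ofLex x (OrderDual.toDual 0)
    have key := Set.WellFoundedOn.prod_lex_of_wellFoundedOn_fiber (rα := (· < ·)) (rβ := (· < ·))
      (f := t) (g := hd) (s := {x : LaurentExponent (p + 1) | (cons W M Y rest).mode
        (exponentShift n fun i => -ofLex x (OrderDual.toDual i)) w b ≠ 0}) ?_ ?_
    · refine key.mono' fun x _ y _ hxy => ?_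
      obtain ⟨i, hi, hi'⟩ := hxy
      by_cases h0 : OrderDual.ofDual i = 0
      · obtain rfl : i = OrderDual.toDual 0 := h0
        have : t x = t y := by
          refine congrArg toLex (funext fun j => ?_)
          exact hi _ (Fin.succ_pos (OrderDual.ofDual j))
        simp only [Function.onFun, this]
        exact Prod.Lex.right _ hi'
      · obtain ⟨i', h'⟩ := Fin.exists_succ_eq.2 h0
        obtain rfl : i = OrderDual.toDual i'.succ := h'.symm
        refine Prod.Lex.left _ _ ⟨OrderDual.toDual i', fun j hj => hi _ ?_, hi'⟩
        exact Fin.succ_lt_succ_iff.2 (show i' < OrderDual.ofDual j from hj)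
    · rw [← Set.wellFoundedOn_image]
      refine Set.WellFoundedOn.subset (ih (fun i => n i.succ) fun i => w i.succ) ?_
      rintro _ ⟨x, hx, rfl⟩ h0
      apply hx
      rw [mode_cons]
      exact (congrArg _ h0).trans (map_zero _)
    · intro a
      rw [← Set.wellFoundedOn_image]
      obtain ⟨N, hN⟩ := Y.truncation (n 0) (w 0) (rest.mode (exponentShift (fun i => n i.succ)
        fun i => -ofLex a (OrderDual.toDual i)) (fun i => w i.succ) b)
      refine BddBelow.wellFoundedOn_lt ⟨-N, ?_⟩
      rintro _ ⟨x, ⟨hx, rfl⟩, rfl⟩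
      by_contra hlt
      apply hx
      have h := hN (-hd x).toNat (by omega)
      rw [mode_cons]
      refine Eq.trans ?_ h
      congr 2
      simp only [exponentShift]
      congr 2
      have : ((-hd x).toNat : ℤ) = -hd x := by omega
      rw [← Int.cast_natCast, this]

end IntertwiningProduct

/-! ### The three kinds of position: w₀, wₚ₊₁, and the arguments of the operators. -/

theorem Fin.eq_zero_or_last_or_middle {p : ℕ} (i : Fin (p + 2)) :
    i = 0 ∨ i = Fin.last (p + 1) ∨ ∃ l : Fin p, i = l.succ.castSucc := by
  induction i using Fin.lastCases with
  | last => exact Or.inr (Or.inl rfl)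
  | cast i =>
    induction i using Fin.cases with
    | zero => exact Or.inl rfl
    | succ l => exact Or.inr (Or.inr ⟨l, rfl⟩)

section update

variable {p : ℕ} {β : Fin (p + 2) → Type*} (w : ∀ i, β i)

theorem Fin.succ_castSucc_ne_zero (i : Fin p) : i.succ.castSucc ≠ 0 :=
  Fin.ne_of_val_ne (Nat.succ_ne_zero _)

theorem Fin.succ_castSucc_ne_last (i : Fin p) : i.succ.castSucc ≠ Fin.last (p + 1) :=
  (Fin.castSucc_lt_last _).ne

theorem Function.update_zero_middle (x : β 0) :
    (fun i : Fin p => Function.update w 0 x i.succ.castSucc) =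
      fun i : Fin p => w i.succ.castSucc :=
  funext fun i => Function.update_of_ne (Fin.succ_castSucc_ne_zero i) _ _

theorem Function.update_last_middle (x : β (Fin.last (p + 1))) :
    (fun i : Fin p => Function.update w (Fin.last (p + 1)) x i.succ.castSucc) =
      fun i : Fin p => w i.succ.castSucc :=
  funext fun i => Function.update_of_ne (Fin.succ_castSucc_ne_last i) _ _

theorem Function.update_middle_middle (l : Fin p) (x : β l.succ.castSucc) :
    (fun i : Fin p => Function.update w l.succ.castSucc x i.succ.castSucc) =
      Function.update (fun i : Fin p => w i.succ.castSucc) l x :=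
  Function.update_comp_eq_of_injective' w
    ((Fin.castSucc_injective _).comp (Fin.succ_injective p)) l x

end update

/-! ### Weights and truncation for the adjoint modes. -/

namespace DiscreteModule

variable {V : Type u} [AddCommGroup V] [Module ℂ V] {𝒱 : VertexOperatorAlgebra V}
  (W : DiscreteModule.{u, v} 𝒱)

theorem adjointMode_apply {k : ℤ} {x : V} (hx : x ∈ 𝒱.grade k) {J : ℕ}
    (hJ : ∀ j, J ≤ j → (𝒱.L_one ^ j) x = 0) (n : ℤ) (w : W.carrier) :
    W.adjointMode n x w = ∑ j ∈ Finset.range J, ((-1 : ℂ) ^ k / (j.factorial : ℂ)) •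
      W.mode (2 * k - n - j - 2) ((𝒱.L_one ^ j) x) w := by
  have h : W.adjointMode n x = ∑ᶠ k : ℤ, ∑ᶠ j : ℕ, ((-1 : ℂ) ^ k / (j.factorial : ℂ)) •
    W.mode (2 * k - n - j - 2) ((𝒱.L_one ^ j) (𝒱.proj k x)) := rfl
  rw [h, finsum_eq_single _ k, finsum_eq_sum_of_support_subset (s := Finset.range J)]
  · rw [LinearMap.sum_apply]
    refine Finset.sum_congr rfl fun j _ => ?_
    rw [VertexOperatorAlgebra.proj, gradeProj_of_mem _ hx, if_pos rfl, LinearMap.smul_apply]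
  · intro j hj
    by_contra hlt
    apply hj
    have hs' : J ≤ j := by simpa using hlt
    simp [VertexOperatorAlgebra.proj, gradeProj_of_mem _ hx, hJ j hs']
  · intro k' hk'
    simp [VertexOperatorAlgebra.proj, gradeProj_of_mem _ hx, hk']

theorem _root_.VertexOperatorAlgebra.exists_L_one_pow_eq_zero {k : ℤ} {x : V}
    (hx : x ∈ 𝒱.grade k) : ∃ J : ℕ, ∀ j, J ≤ j → (𝒱.L_one ^ j) x = 0 := by
  obtain ⟨M, hM⟩ := (𝒱.L_one_pow_support hx).bddAbove
  refine ⟨M + 1, fun j hj => ?_⟩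
  by_contra hne
  exact absurd (hM hne) (by omega)

/-- Applying L(1)ʲ lowers the weight of x by j, and the mode index drops by j too, so all summands
shift weights equally, by the opposite of what xₙ does. -/
theorem adjointMode_mem {k : ℤ} {x : V} (hx : x ∈ 𝒱.grade k) {r : ℝ} {w : W.carrier}
    (hw : w ∈ W.grade r) (n : ℤ) : W.adjointMode n x w ∈ W.grade (r - k + n + 1) := by
  obtain ⟨J, hJ⟩ := 𝒱.exists_L_one_pow_eq_zero hx
  rw [W.adjointMode_apply hx hJ]
  refine sum_mem fun j _ => Submodule.smul_mem _ _ ?_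
  have h := W.mode_mem (𝒱.L_one_pow_mem hx j) hw (2 * k - n - j - 2)
  convert h using 1
  push_cast
  ring_nf

/-- The operator x₋₁₋ᵢ need not vanish on the contragredient for large i, but its transpose consists
of finitely many modes whose indices tend to +∞ with i. This makes the first sum in
`correlator_iterate` finite uniformly in the intertwining operators. -/
theorem eventually_adjointMode_eq_zero {k : ℤ} {x : V} (hx : x ∈ 𝒱.grade k) (w : W.carrier) :
    ∀ᶠ i : ℕ in atTop, W.adjointMode (-1 - i) x w = 0 := by
  obtain ⟨J, hJ⟩ := 𝒱.exists_L_one_pow_eq_zero hx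
  choose N hN using fun j : ℕ => W.truncation ((𝒱.L_one ^ j) x) w
  have : ∀ᶠ i : ℕ in atTop, ∀ j ∈ Finset.range J, N j ≤ 2 * k - (-1 - i) - j - 2 := by
    rw [eventually_all_finset]
    intro j _
    filter_upwards [eventually_ge_atTop (N j - 2 * k + j + 1).toNat] with i hi
    omega
  filter_upwards [this] with i hi
  rw [W.adjointMode_apply hx hJ]
  exact Finset.sum_eq_zero fun j hj => by rw [hN j _ (hi j hj), smul_zero]

theorem eventually_mode_eq_zero (x : V) (w : W.carrier) :
    ∀ᶠ i : ℕ in atTop, W.mode i x w = 0 := by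
  obtain ⟨N, hN⟩ := W.truncation x w
  filter_upwards [eventually_ge_atTop N.toNat] with i hi
  exact hN i (by omega)

end DiscreteModule

section LaurentExponent

variable {p : ℕ}

theorem mixedSeries_self (l : Fin p) (s : ℕ) : mixedSeries l l s = 0 := by
  unfold mixedSeries HahnSeries.monomialSum
  split_ifs with h
  · ext x
    rw [HahnSeries.SummableFamily.coeff_hsum]
    refine finsum_eq_zero_of_forall_eq_zero fun i => ?_
    change (HahnSeries.single _ _).coeff x = 0
    simp [mixedCoeff]
  · rfl

theorem mixedSeries_mem (l j : Fin p) (s : ℕ) : mixedSeries l j s ∈ (laurentExpansion p).range := by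
  by_cases h : l = j
  · rw [h, mixedSeries_self]
    exact zero_mem _
  · exact mixedSeries_mem_range h s

theorem coeff_mixedSeries_mul (l j : Fin p) (s : ℕ) (f : HahnSeries (LaurentExponent p) ℂ)
    (x : LaurentExponent p) : ∀ᶠ N : ℕ in atTop, (mixedSeries l j s * f).coeff x =
      ∑ i ∈ Finset.range N, (mixedCoeff l j s i : ℂ) *
        f.coeff (x - laurentExponent (mixedExponent l j s i)) := by
  by_cases h : l = j
  · refine Eventually.of_forall fun N => ?_
    subst h
    rw [mixedSeries_self, zero_mul]
    simp [mixedCoeff]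
  · exact HahnSeries.coeff_monomialSum_mul (mixedExponent_strictMono h s) _ f x

theorem coeff_laurentVariable_zpow_mul (j : Fin p) (m : ℤ) (f : HahnSeries (LaurentExponent p) ℂ)
    (x : LaurentExponent p) : (laurentVariable j ^ m * f).coeff x =
      f.coeff (x - laurentExponent (Pi.single j m)) := by
  rw [laurentVariable_zpow, HahnSeries.coeff_single_mul, one_mul]

end LaurentExponent

/-! ### Correlators as Hahn series, and the Jacobi identity for them. -/

section correlator

variable {V : Type u} [AddCommGroup V] [Module ℂ V] {𝒱 : VertexOperatorAlgebra V}
  {p : ℕ} {W : Fin (p + 2) → DiscreteModule.{u, v} 𝒱}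

variable (W) in
/-- The products of intertwining operators of the theorem, together with a base point in the space
of exponents. -/
abbrev CorrelatorIndex : Type (max u (v + 1)) :=
  IntertwiningProduct 𝒱 (W (Fin.last (p + 1))) p (fun i => W i.succ.castSucc) (W 0).contragredient ×
    (Fin p → ℂ)

/-- The part of the matrix element with exponents in a coset of the integral ones. -/
noncomputable def correlatorSeries (Y : CorrelatorIndex W) (w : ∀ i, (W i).carrier) :
    HahnSeries (LaurentExponent p) ℂ where
  coeff x := matrixElement Y.1 (w 0) (fun i => w i.succ.castSucc) (w (Fin.last (p + 1)))
    (exponentShift Y.2 fun i => ofLex x (OrderDual.toDual i))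
  isPWO_support' := by
    refine (Y.1.isPWO_support (fun i => -Y.2 i - 1) (fun i => w i.succ.castSucc)
      (w (Fin.last (p + 1)))).mono fun x hx h0 => hx ?_
    have e : (fun i => -exponentShift Y.2 (fun i => ofLex x (OrderDual.toDual i)) i - 1) =
        exponentShift (fun i => -Y.2 i - 1) fun i => -ofLex x (OrderDual.toDual i) := by
      ext i
      simp only [exponentShift]
      push_cast
      ring
    simp only [matrixElement]
    rw [e, h0]
    rfl

/-- The exponents `-e - 1 - x`, where `e` is the base point of `Y`. -/
def modeIndex (Y : CorrelatorIndex W) (x : LaurentExponent p) : Fin p → ℂ :=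
  exponentShift (fun i => -Y.2 i - 1) fun i => -ofLex x (OrderDual.toDual i)

theorem modeIndex_sub (Y : CorrelatorIndex W) (x : LaurentExponent p) (a : Fin p → ℤ) :
    modeIndex Y (x - laurentExponent a) = exponentShift (modeIndex Y x) a := by
  ext i
  change -Y.2 i - 1 + ((-(ofLex x (OrderDual.toDual i) - a i) : ℤ) : ℂ) =
    -Y.2 i - 1 + ((-(ofLex x (OrderDual.toDual i)) : ℤ) : ℂ) + (a i : ℂ)
  push_cast
  ring

/-- Evaluation of an element of the contragredient module at a vector. -/
noncomputable def DiscreteModule.evalₗ (W₀ : DiscreteModule.{u, v} 𝒱) (x : W₀.carrier) :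
    W₀.contragredient.carrier →ₗ[ℂ] ℂ :=
  LinearMap.applyₗ x ∘ₗ W₀.gradedDual.subtype

theorem DiscreteModule.evalₗ_mode (W₀ : DiscreteModule.{u, v} 𝒱) (x : W₀.carrier) (n : ℤ) (u : V)
    (f : W₀.contragredient.carrier) :
    W₀.evalₗ x (W₀.contragredient.mode n u f) = W₀.evalₗ (W₀.adjointMode n u x) f := rfl

theorem DiscreteModule.evalₗ_add (W₀ : DiscreteModule.{u, v} 𝒱) (x y : W₀.carrier)
    (f : W₀.contragredient.carrier) : W₀.evalₗ (x + y) f = W₀.evalₗ x f + W₀.evalₗ y f :=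
  map_add (W₀.gradedDual.subtype f) x y

theorem DiscreteModule.evalₗ_smul (W₀ : DiscreteModule.{u, v} 𝒱) (c : ℂ) (x : W₀.carrier)
    (f : W₀.contragredient.carrier) : W₀.evalₗ (c • x) f = c • W₀.evalₗ x f :=
  map_smul (W₀.gradedDual.subtype f) c x

theorem coeff_correlatorSeries (Y : CorrelatorIndex W) (w : ∀ i, (W i).carrier)
    (x : LaurentExponent p) : (correlatorSeries Y w).coeff x =
      (W 0).evalₗ (w 0) (Y.1.mode (modeIndex Y x) (fun i => w i.succ.castSucc)
        (w (Fin.last (p + 1)))) := by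
  have e : modeIndex Y x =
      fun i => -exponentShift Y.2 (fun i => ofLex x (OrderDual.toDual i)) i - 1 := by
    ext i
    simp only [exponentShift, modeIndex]
    push_cast
    ring
  rw [e]
  rfl

theorem coeff_correlatorSeries_update_zero (Y : CorrelatorIndex W) (w : ∀ i, (W i).carrier)
    (a : (W 0).carrier) (x : LaurentExponent p) :
    (correlatorSeries Y (Function.update w 0 a)).coeff x =
      (W 0).evalₗ a (Y.1.mode (modeIndex Y x) (fun i => w i.succ.castSucc)
        (w (Fin.last (p + 1)))) := by
  rw [coeff_correlatorSeries, Function.update_zero_middle, Function.update_self,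
    Function.update_of_ne (Fin.last_pos).ne']

theorem coeff_correlatorSeries_update_last (Y : CorrelatorIndex W) (w : ∀ i, (W i).carrier)
    (a : (W (Fin.last (p + 1))).carrier) (x : LaurentExponent p) :
    (correlatorSeries Y (Function.update w (Fin.last (p + 1)) a)).coeff x =
      (W 0).evalₗ (w 0) (Y.1.mode (modeIndex Y x) (fun i => w i.succ.castSucc) a) := by
  rw [coeff_correlatorSeries, Function.update_last_middle, Function.update_self,
    Function.update_of_ne (Fin.last_pos).ne]

theorem coeff_correlatorSeries_update_middle (Y : CorrelatorIndex W) (w : ∀ i, (W i).carrier)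
    (l : Fin p) (a : (W l.succ.castSucc).carrier) (x : LaurentExponent p) :
    (correlatorSeries Y (Function.update w l.succ.castSucc a)).coeff x =
      (W 0).evalₗ (w 0) (Y.1.mode (modeIndex Y x)
        (Function.update (fun i : Fin p => w i.succ.castSucc) l a) (w (Fin.last (p + 1)))) := by
  rw [coeff_correlatorSeries, Function.update_middle_middle,
    Function.update_of_ne (Fin.succ_castSucc_ne_last l).symm,
    Function.update_of_ne (Fin.succ_castSucc_ne_zero l).symm]

variable (W) in
/-- All matrix elements at once, as a multilinear function of the vectors. -/
noncomputable def correlator : MultilinearMap ℂ (fun i => (W i).carrier)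
    (CorrelatorIndex W → HahnSeries (LaurentExponent p) ℂ) :=
  MultilinearMap.mk' (fun w Y => correlatorSeries Y w)
    (fun w i a b => by
      ext Y x
      simp only [Pi.add_apply, HahnSeries.coeff_add]
      obtain rfl | rfl | ⟨l, rfl⟩ := i.eq_zero_or_last_or_middle
      · simp only [coeff_correlatorSeries_update_zero, DiscreteModule.evalₗ_add]
      · simp only [coeff_correlatorSeries_update_last, ← IntertwiningProduct.modeₗ_apply, map_add]
      · simp only [coeff_correlatorSeries_update_middle, IntertwiningProduct.mode_update_add,
          map_add])
    (fun w i c a => by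
      ext Y x
      simp only [Pi.smul_apply, HahnSeries.coeff_smul]
      obtain rfl | rfl | ⟨l, rfl⟩ := i.eq_zero_or_last_or_middle
      · simp only [coeff_correlatorSeries_update_zero, DiscreteModule.evalₗ_smul]
      · simp only [coeff_correlatorSeries_update_last, ← IntertwiningProduct.modeₗ_apply, map_smul]
      · simp only [coeff_correlatorSeries_update_middle, IntertwiningProduct.mode_update_smul,
          map_smul])

theorem correlator_apply (w : ∀ i, (W i).carrier) (Y : CorrelatorIndex W) :
    correlator W w Y = correlatorSeries Y w := rfl

/-- The pairing turns the leftmost uₘ of `mode_commutator` into its transpose on w₀, and a shift of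
the j-th mode index is multiplication by a power of zⱼ. -/
theorem correlator_commutator (w : ∀ i, (W i).carrier) (u : V) (m : ℤ) {S : ℕ}
    (hS : ∀ i, ∀ s : ℕ, S ≤ s → (W i).mode s u (w i) = 0) :
    correlator W (Function.update w 0 ((W 0).adjointMode m u (w 0))) =
      correlator W (Function.update w (Fin.last (p + 1)) ((W _).mode m u (w (Fin.last (p + 1))))) +
      ∑ j : Fin p, ∑ s ∈ Finset.range S, ((Ring.choose m s : ℤ) : ℂ) • laurentVariable j ^ (m - s) •
        correlator W (Function.update w j.succ.castSucc ((W _).mode s u (w j.succ.castSucc))) := by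
  ext Y x
  simp only [Pi.add_apply, HahnSeries.coeff_add, Finset.sum_apply, HahnSeries.coeff_sum,
    Pi.smul_apply, HahnSeries.coeff_smul, smul_eq_mul, coeff_laurentVariable_zpow_mul,
    correlator_apply, coeff_correlatorSeries_update_zero, coeff_correlatorSeries_update_last,
    coeff_correlatorSeries_update_middle, modeIndex_sub, ← DiscreteModule.evalₗ_mode]
  rw [Y.1.mode_commutator _ _ _ u m fun j => hS _]
  simp only [map_add, map_sum, map_smul, smul_eq_mul]

theorem correlator_iterate (w : ∀ i, (W i).carrier) (u : V) (l : Fin p) {S : ℕ}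
    (hS : ∀ i, ∀ s : ℕ, S ≤ s → (W i).mode s u (w i) = 0)
    (hS' : ∀ s : ℕ, S ≤ s → (W 0).adjointMode (-1 - s) u (w 0) = 0) :
    correlator W (Function.update w l.succ.castSucc ((W _).mode (-1) u (w l.succ.castSucc))) =
      ∑ i ∈ Finset.range S, laurentVariable l ^ (i : ℤ) •
        correlator W (Function.update w 0 ((W 0).adjointMode (-1 - i) u (w 0))) +
      ∑ i ∈ Finset.range S, laurentVariable l ^ (-1 - i : ℤ) •
        correlator W (Function.update w (Fin.last (p + 1))
          ((W _).mode i u (w (Fin.last (p + 1))))) +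
      ∑ j : Fin p, ∑ s ∈ Finset.range S, mixedSeries l j s •
        correlator W (Function.update w j.succ.castSucc ((W _).mode s u (w j.succ.castSucc))) := by
  ext Y x
  have h₁ := Y.1.mode_iterate (modeIndex Y x) (fun i => w i.succ.castSucc) (w (Fin.last (p + 1)))
    u l (S := S) fun j => hS _
  have h₂ : ∀ᶠ N : ℕ in atTop, ∀ j : Fin p, ∀ s ∈ Finset.range S, (mixedSeries l j s •
      correlator W (Function.update w j.succ.castSucc
        ((W _).mode s u (w j.succ.castSucc))) Y).coeff x = _ :=
    eventually_all.2 fun j => (eventually_all_finset _).2 fun s _ => coeff_mixedSeries_mul l j s _ x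
  -- N may depend on the operators and on the coefficient considered; the terms between S and N
  -- vanish by `hS` and `hS'`, so the resulting formula does not involve N.
  obtain ⟨N, h₁, h₂, hN⟩ := (h₁.and (h₂.and (eventually_ge_atTop S))).exists
  simp only [Pi.add_apply, HahnSeries.coeff_add, Finset.sum_apply, HahnSeries.coeff_sum,
    Pi.smul_apply]
  rw [Finset.sum_congr rfl fun j _ => Finset.sum_congr rfl fun s hs => h₂ j s hs]
  simp only [smul_eq_mul, coeff_laurentVariable_zpow_mul,
    correlator_apply, coeff_correlatorSeries_update_zero, coeff_correlatorSeries_update_last,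
    coeff_correlatorSeries_update_middle, modeIndex_sub, ← DiscreteModule.evalₗ_mode]
  rw [h₁]
  simp only [map_add, map_sum, map_smul, smul_eq_mul]
  congr 2
  · refine (Finset.sum_subset (Finset.range_subset_range.2 hN) fun i _ hi => ?_).symm
    rw [DiscreteModule.evalₗ_mode, hS' i (by simpa using hi)]
    exact map_zero ((W 0).gradedDual.subtype _)
  · refine (Finset.sum_subset (Finset.range_subset_range.2 hN) fun i _ hi => ?_).symm
    rw [hS _ i (by simpa using hi), ← IntertwiningProduct.modeₗ_apply, map_zero, map_zero]

end correlator

/-! ### Lower bound of the weights and C₁-cofiniteness. -/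

namespace DiscreteModule

variable {V : Type u} [AddCommGroup V] [Module ℂ V] {𝒱 : VertexOperatorAlgebra V}
  (W : DiscreteModule.{u, v} 𝒱)

/-- Nonzero vectors of distinct weights are independent, so only finitely many weights occur in the
finite-dimensional part of weight at most 0. -/
theorem exists_grade_eq_bot : ∃ b : ℝ, ∀ r < b, W.grade r = ⊥ := by
  let F : Submodule ℂ W.carrier := ⨆ s : Set.Iic (0 : ℝ), W.grade s
  have : FiniteDimensional ℂ F := W.discrete 0
  let S : Set ℝ := {r | r ≤ 0 ∧ W.grade r ≠ ⊥}
  have hex : ∀ s : S, ∃ x ∈ W.grade s, x ≠ 0 := fun s =>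
    Submodule.exists_mem_ne_zero_of_ne_bot s.2.2
  choose x hx hx0 using hex
  have hind : iSupIndep fun s : S => W.grade s :=
    W.isInternal.submodule_iSupIndep.comp Subtype.val_injective
  have hli : LinearIndependent ℂ x := hind.linearIndependent _ hx hx0
  have hF : ∀ s, x s ∈ F := fun s =>
    (le_iSup (fun t : Set.Iic (0 : ℝ) => W.grade t) ⟨s, s.2.1⟩) (hx s)
  have hli' : LinearIndependent ℂ fun s => (⟨x s, hF s⟩ : F) :=
    LinearIndependent.of_comp F.subtype hli
  have hfin : Finite S := hli'.finite
  obtain ⟨b, hb⟩ := (Set.toFinite S).bddBelow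
  refine ⟨min b 0, fun r hr => ?_⟩
  by_contra hne
  exact absurd (hb (show r ∈ S from ⟨(hr.trans_le (min_le_right _ _)).le, hne⟩))
    (not_le.2 (hr.trans_le (min_le_left _ _)))

variable {W} in
/-- In a `C₁`-cofinite module, the vectors of large weight are combinations of vectors `u₋₁ w` with
`u` and `w` homogeneous. -/
theorem IsC₁Cofinite.exists_weight_bound (hW : W.IsC₁Cofinite) : ∃ N : ℝ, ∀ r, N < r →
    W.grade r ≤ Submodule.span ℂ {x | ∃ k : ℤ, 0 < k ∧ ∃ u ∈ 𝒱.grade k,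
      ∃ w ∈ W.grade (r - k), x = W.mode (-1) u w} := by
  classical
  obtain ⟨P, hP⟩ := W.C₁.exists_isCompl
  have : FiniteDimensional ℂ (W.carrier ⧸ W.C₁) := hW
  have : FiniteDimensional ℂ P := (Submodule.quotientEquivOfIsCompl _ _ hP).finiteDimensional
  obtain ⟨T, hT⟩ := (Submodule.fg_iff_finiteDimensional P).2 inferInstance
  -- N bounds the weights occurring in a finite spanning set of a complement of C₁(W). Above N the
  -- complement projects to zero, so a vector of such weight is the projection of its C₁ part.
  obtain ⟨N, hN⟩ := (Set.Finite.biUnion T.finite_toSet fun t _ =>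
    gradeProj_support W.isInternal t).bddAbove
  refine ⟨N, fun r hr w hw => ?_⟩
  have hkill : ∀ y ∈ P, gradeProj W.isInternal r y = 0 := by
    intro y hy
    rw [← hT] at hy
    induction hy using Submodule.span_induction with
    | mem t ht =>
      by_contra hne
      exact absurd (hN (Set.mem_biUnion ht hne)) (not_le.2 hr)
    | zero => exact map_zero _
    | add y z _ _ hy hz => rw [map_add, hy, hz, add_zero]
    | smul c y _ hy => rw [map_smul, hy, smul_zero]
  have hC : ∀ y ∈ W.C₁, gradeProj W.isInternal r y ∈
      Submodule.span ℂ {x | ∃ k : ℤ, 0 < k ∧ ∃ u ∈ 𝒱.grade k,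
        ∃ w ∈ W.grade (r - k), x = W.mode (-1) u w} := by
    intro y hy
    induction hy using Submodule.span_induction with
    | zero => rw [map_zero]; exact zero_mem _
    | add y z _ _ hy hz => rw [map_add]; exact add_mem hy hz
    | smul c y _ hy => rw [map_smul]; exact Submodule.smul_mem _ _ hy
    | mem x hx =>
      obtain ⟨u, hu, w, rfl⟩ := hx
      induction hu using Submodule.iSup_induction' with
      | zero => simp
      | add u u' _ _ h h' =>
        rw [map_add, LinearMap.add_apply, map_add]
        exact add_mem h h'
      | mem k u hu =>
        have hw : w ∈ ⨆ s, W.grade s := by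
          rw [W.isInternal.submodule_iSup_eq_top]; trivial
        induction hw using Submodule.iSup_induction' with
        | zero => simp
        | add w w' _ _ h h' =>
          rw [map_add, map_add]
          exact add_mem h h'
        | mem s w hw =>
          have h := W.mode_mem hu hw (-1)
          rw [gradeProj_of_mem _ h]
          split_ifs with hrs
          · refine Submodule.subset_span ⟨k, k.2, u, hu, w, ?_, rfl⟩
            have : r - ((k : ℤ) : ℝ) = s := by
              rw [hrs]; push_cast; ring
            rwa [this]
          · exact zero_mem _
  have htop : w ∈ W.C₁ ⊔ P := by rw [hP.sup_eq_top]; trivial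
  obtain ⟨c, hc, y, hy, rfl⟩ := Submodule.mem_sup.1 htop
  have h := gradeProj_of_mem W.isInternal hw r
  rw [if_pos rfl, map_add, hkill y hy, add_zero] at h
  rw [← h]
  exact hC c hc

end DiscreteModule

theorem MultilinearMap.apply_mem_of_mem_span {R ι : Type*} [CommSemiring R] [Fintype ι]
    {M : ι → Type*} {N : Type*} [∀ i, AddCommMonoid (M i)] [∀ i, Module R (M i)] [AddCommMonoid N]
    [Module R N] (f : MultilinearMap R M N) (P : Submodule R N) (T : ∀ i, Set (M i))
    (h : ∀ w : ∀ i, M i, (∀ i, w i ∈ T i) → f w ∈ P) (w : ∀ i, M i)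
    (hw : ∀ i, w i ∈ Submodule.span R (T i)) : f w ∈ P := by
  classical
  suffices key : ∀ s : Finset ι, ∀ w : ∀ i, M i, (∀ i ∈ s, w i ∈ Submodule.span R (T i)) →
      (∀ i ∉ s, w i ∈ T i) → f w ∈ P from
    key Finset.univ w (fun i _ => hw i) fun i hi => absurd (Finset.mem_univ i) hi
  intro s
  induction s using Finset.induction_on with
  | empty => exact fun w _ hw => h w fun i => hw i (Finset.notMem_empty i)
  | insert i s hi ih =>
    intro w hw hw'
    rw [← Function.update_eq_self i w]
    have hx := hw i (Finset.mem_insert_self i s)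
    generalize w i = x at hx
    induction hx using Submodule.span_induction with
    | zero => rw [f.map_update_zero]; exact zero_mem _
    | add x y _ _ hx hy => rw [f.map_update_add]; exact add_mem hx hy
    | smul c x _ hx => rw [f.map_update_smul]; exact Submodule.smul_mem _ _ hx
    | mem x hx =>
      refine ih _ (fun j hj => ?_) fun j hj => ?_
      · have hji : j ≠ i := fun h => hi (h ▸ hj)
        rw [Function.update_of_ne hji]
        exact hw j (Finset.mem_insert_of_mem hj)
      · by_cases hji : j = i
        · subst hji
          rwa [Function.update_self]
        · rw [Function.update_of_ne hji]
          exact hw' j (by simp [hji, hj])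

theorem Fintype.sum_update_eq {ι : Type*} [Fintype ι] [DecidableEq ι] (r : ι → ℝ) (i : ι) (x : ℝ) :
    ∑ j, Function.update r i x j = ∑ j, r j + x - r i := by
  have h : Function.update r i x = r + Pi.single i (x - r i) := by
    ext j
    by_cases hj : j = i
    · subst hj; simp
    · simp [hj]
  simp only [h, Pi.add_apply, Finset.sum_add_distrib, Finset.sum_pi_single', Finset.mem_univ,
    if_true]
  ring

/-! ### Reduction of the total weight. -/

section correlator

variable {V : Type u} [AddCommGroup V] [Module ℂ V] {𝒱 : VertexOperatorAlgebra V}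
  {p : ℕ} {W : Fin (p + 2) → DiscreteModule.{u, v} 𝒱}

/-- A submodule over the image of the coefficient ring, as a complex vector space. -/
def Submodule.toComplexSubspace {ι : Type*}
    (P : Submodule (laurentExpansion p).range (ι → HahnSeries (LaurentExponent p) ℂ)) :
    Submodule ℂ (ι → HahnSeries (LaurentExponent p) ℂ) where
  __ := P.toAddSubmonoid
  smul_mem' c x hx := by
    have h : c • x = (⟨HahnSeries.single 0 c, single_mem_range c⟩ : (laurentExpansion p).range) • x
    · ext i y
      exact (HahnSeries.coeff_single_zero_mul).symm
    rw [h]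
    exact P.smul_mem _ hx

variable (W) in
/-- The module spanned by the matrix elements of homogeneous vectors of total weight at most `t`. -/
noncomputable def weightSpan (t : ℝ) : Submodule (laurentExpansion p).range
    (CorrelatorIndex W → HahnSeries (LaurentExponent p) ℂ) :=
  Submodule.span _ {f | ∃ (w : ∀ i, (W i).carrier) (r : Fin (p + 2) → ℝ),
    (∀ i, w i ∈ (W i).grade (r i)) ∧ ∑ i, r i ≤ t ∧ f = correlator W w}

theorem smul_mem_weightSpan {t : ℝ} {a : HahnSeries (LaurentExponent p) ℂ}
    (ha : a ∈ (laurentExpansion p).range) {f} (hf : f ∈ weightSpan W t) : a • f ∈ weightSpan W t :=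
  (weightSpan W t).smul_mem ⟨a, ha⟩ hf

theorem complex_smul_mem_weightSpan {t : ℝ} (c : ℂ) {f} (hf : f ∈ weightSpan W t) :
    c • f ∈ weightSpan W t :=
  (weightSpan W t).toComplexSubspace.smul_mem c hf

variable {w : ∀ i, (W i).carrier} {r : Fin (p + 2) → ℝ}

theorem correlator_update_mem_weightSpan (hw : ∀ i, w i ∈ (W i).grade (r i)) {i : Fin (p + 2)}
    {x : (W i).carrier} {s t : ℝ} (hx : x ∈ (W i).grade s) (h : ∑ j, r j + s - r i ≤ t) :
    correlator W (Function.update w i x) ∈ weightSpan W t := by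
  refine Submodule.subset_span ⟨_, Function.update r i s, fun j => ?_, ?_, rfl⟩
  · by_cases hj : j = i
    · subst hj; simpa using hx
    · simpa [hj] using hw j
  · rwa [Fintype.sum_update_eq]

theorem exists_forall_mode_eq_zero (w : ∀ i, (W i).carrier) (u : V) :
    ∃ S : ℕ, ∀ i, ∀ s : ℕ, S ≤ s → (W i).mode s u (w i) = 0 := by
  obtain ⟨S, hS⟩ := (eventually_all.2 fun i => (W i).eventually_mode_eq_zero u (w i)
    ).exists_forall_of_atTop
  exact ⟨S, fun i s hs => hS s hs i⟩

theorem correlator_mode_mem_weightSpan (hw : ∀ i, w i ∈ (W i).grade (r i)) {k : ℤ} {u : V}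
    (hu : u ∈ 𝒱.grade k) (i : Fin (p + 2)) {n : ℤ} {t : ℝ} (h : ∑ j, r j + k - n - 1 ≤ t) :
    correlator W (Function.update w i ((W i).mode n u (w i))) ∈ weightSpan W t :=
  correlator_update_mem_weightSpan hw ((W i).mode_mem hu (hw i) n) (by linarith)

theorem correlator_adjointMode_mem_weightSpan (hw : ∀ i, w i ∈ (W i).grade (r i)) {k : ℤ} {u : V}
    (hu : u ∈ 𝒱.grade k) {n : ℤ} {t : ℝ} (h : ∑ j, r j - k + n + 1 ≤ t) :
    correlator W (Function.update w 0 ((W 0).adjointMode n u (w 0))) ∈ weightSpan W t :=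
  correlator_update_mem_weightSpan hw ((W 0).adjointMode_mem hu (hw 0) n) (by linarith)

/-- A second bound, for when the transpose raises the weight of w₀ too much: the commutator formula
trades it for uₙ on the last vector and modes uₛ, s ≥ 0, on the others. -/
theorem correlator_adjointMode_mem_weightSpan' (hw : ∀ i, w i ∈ (W i).grade (r i)) {k : ℤ} {u : V}
    (hu : u ∈ 𝒱.grade k) {n : ℤ} {t : ℝ} (h : ∑ j, r j + k - n - 1 ≤ t)
    (h' : ∑ j, r j + k - 1 ≤ t) :
    correlator W (Function.update w 0 ((W 0).adjointMode n u (w 0))) ∈ weightSpan W t := by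
  obtain ⟨S, hS⟩ := exists_forall_mode_eq_zero w u
  rw [correlator_commutator w u n hS]
  refine add_mem (correlator_mode_mem_weightSpan hw hu _ h) ?_
  refine sum_mem fun j _ => sum_mem fun s _ => ?_
  refine complex_smul_mem_weightSpan _ (smul_mem_weightSpan (laurentVariable_zpow_mem_range j _) ?_)
  refine correlator_mode_mem_weightSpan hw hu _ (le_trans ?_ h')
  have : (0 : ℝ) ≤ s := Nat.cast_nonneg s
  push_cast
  linarith

/-- On w₀ only transposes can be moved to the other vectors. Up to sign, the mode u_{k'-k-1} is the
leading term of the transpose of u_{k'+k-1}, and the other terms are modes of the same shape for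
L(1)ʲu, of weight k' - j; hence the induction on the nilpotency order m of L(1) on u. The case k' =
k is u₋₁. -/
theorem correlator_mode_zero_mem_weightSpan (hw : ∀ i, w i ∈ (W i).grade (r i)) {k : ℤ}
    (hk : 0 < k) (m : ℕ) : ∀ {k' : ℤ} {u : V}, u ∈ 𝒱.grade k' → k' ≤ k →
      (∀ j, m ≤ j → (𝒱.L_one ^ j) u = 0) →
      correlator W (Function.update w 0 ((W 0).mode (k' - k - 1) u (w 0))) ∈
        weightSpan W (∑ j, r j + k - 1) := by
  have hk1 : (1 : ℝ) ≤ k := by exact_mod_cast hk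
  induction m with
  | zero =>
    intro k' u hu _ h0
    have : u = 0 := h0 0 le_rfl
    rw [this, map_zero, LinearMap.zero_apply, MultilinearMap.map_update_zero]
    exact zero_mem _
  | succ m ih =>
    intro k' u hu hk' h0
    have hk'' : (k' : ℝ) ≤ k := by exact_mod_cast hk'
    have h := correlator_adjointMode_mem_weightSpan' (n := k' + k - 1) (t := ∑ j, r j + k - 1) hw hu
      (by push_cast; linarith) (by linarith)
    rw [(W 0).adjointMode_apply hu h0, Finset.sum_range_succ', MultilinearMap.map_update_add,
      MultilinearMap.map_update_smul] at h
    have hsum : correlator W (Function.update w 0 (∑ j ∈ Finset.range m,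
        ((-1 : ℂ) ^ k' / ((j + 1).factorial : ℂ)) • (W 0).mode
          (2 * k' - (k' + k - 1) - ((j + 1 : ℕ) : ℤ) - 2) ((𝒱.L_one ^ (j + 1)) u) (w 0))) ∈
        weightSpan W (∑ j, r j + k - 1) := by
      rw [MultilinearMap.map_update_sum]
      refine sum_mem fun j _ => ?_
      rw [MultilinearMap.map_update_smul]
      refine complex_smul_mem_weightSpan _ ?_
      have := ih (𝒱.L_one_pow_mem hu (j + 1)) (by push_cast; omega) fun i hi => by
        rw [← Module.End.mul_apply, ← pow_add]
        exact h0 _ (by omega)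
      have e : 2 * k' - (k' + k - 1) - ((j + 1 : ℕ) : ℤ) - 2 = k' - ((j + 1 : ℕ) : ℤ) - k - 1 := by
        ring
      rwa [e]
    have h1 := complex_smul_mem_weightSpan ((-1 : ℂ) ^ k') ((add_mem_cancel_left hsum).1 h)
    rw [smul_smul] at h1
    have hc : (-1 : ℂ) ^ k' * ((-1 : ℂ) ^ k' / ((Nat.factorial 0 : ℕ) : ℂ)) = 1 := by
      rw [Nat.factorial_zero, Nat.cast_one, div_one, ← mul_zpow]
      simp
    rw [hc, one_smul] at h1
    have e : 2 * k' - (k' + k - 1) - ((0 : ℕ) : ℤ) - 2 = k' - k - 1 := by push_cast; ring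
    rwa [e, pow_zero, Module.End.one_apply] at h1

/-- The matrix elements with `u₋₁ wᵢ` in place of `wᵢ` lie in the module spanned by those of
smaller total weight. -/
theorem correlator_mode_neg_one_mem_weightSpan (hw : ∀ i, w i ∈ (W i).grade (r i)) {k : ℤ}
    (hk : 0 < k) {u : V} (hu : u ∈ 𝒱.grade k) (i : Fin (p + 2)) :
    correlator W (Function.update w i ((W i).mode (-1) u (w i))) ∈
      weightSpan W (∑ j, r j + k - 1) := by
  have hk1 : (1 : ℝ) ≤ k := by exact_mod_cast hk
  obtain ⟨S, hS⟩ := exists_forall_mode_eq_zero w u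
  have hmode : ∀ (i : Fin (p + 2)) (s : ℕ), correlator W (Function.update w i
      ((W i).mode s u (w i))) ∈ weightSpan W (∑ j, r j + k - 1) := fun i s => by
    refine correlator_mode_mem_weightSpan hw hu _ ?_
    have : (0 : ℝ) ≤ s := Nat.cast_nonneg s
    push_cast
    linarith
  have hadj : ∀ s : ℕ, correlator W (Function.update w 0
      ((W 0).adjointMode (-1 - s) u (w 0))) ∈ weightSpan W (∑ j, r j + k - 1) := fun s => by
    refine correlator_adjointMode_mem_weightSpan hw hu ?_
    have : (0 : ℝ) ≤ s := Nat.cast_nonneg s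
    push_cast
    linarith
  obtain rfl | rfl | ⟨l, rfl⟩ := i.eq_zero_or_last_or_middle
  · obtain ⟨J, hJ⟩ := 𝒱.exists_L_one_pow_eq_zero hu
    simpa using correlator_mode_zero_mem_weightSpan hw hk J hu le_rfl hJ
  -- For the last vector the commutator formula with m = -1 is solved for the term containing
  -- u₋₁wₚ₊₁.
  · have h := hadj 0
    rw [Nat.cast_zero, sub_zero, correlator_commutator w u (-1) hS] at h
    refine (add_mem_cancel_right (sum_mem fun j _ => sum_mem fun s _ => ?_)).1 h
    exact complex_smul_mem_weightSpan _
      (smul_mem_weightSpan (laurentVariable_zpow_mem_range j _) (hmode _ s))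
  · obtain ⟨S', hS'⟩ := ((W 0).eventually_adjointMode_eq_zero hu (w 0)).exists_forall_of_atTop
    rw [correlator_iterate w u l (S := max S S')
      (fun i s hs => hS i s ((le_max_left _ _).trans hs))
      fun s hs => hS' s ((le_max_right _ _).trans hs)]
    refine add_mem (add_mem ?_ ?_) ?_
    · exact sum_mem fun s _ => smul_mem_weightSpan (laurentVariable_zpow_mem_range l _) (hadj s)
    · exact sum_mem fun s _ => smul_mem_weightSpan (laurentVariable_zpow_mem_range l _) (hmode _ s)
    · exact sum_mem fun j _ => sum_mem fun s _ =>
        smul_mem_weightSpan (mixedSeries_mem l j s) (hmode _ s)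

/-! ### Finite generation. -/

variable (W) in
/-- The module spanned by the matrix elements of vectors whose weights are at most `N`. -/
noncomputable def boundedSpan (N : ℝ) : Submodule (laurentExpansion p).range
    (CorrelatorIndex W → HahnSeries (LaurentExponent p) ℂ) :=
  Submodule.span _ (correlator W '' {w | ∀ i, w i ∈ ⨆ s : Set.Iic N, (W i).grade s})

/-- By discreteness the vectors of weight at most N form finite-dimensional spaces, and by
multilinearity finite spanning sets of these suffice. -/
theorem boundedSpan_fg (N : ℝ) : (boundedSpan W N).FG := by
  have hfin : ∀ i, ∃ T : Finset (W i).carrier,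
      Submodule.span ℂ (T : Set (W i).carrier) = ⨆ s : Set.Iic N, (W i).grade s := fun i =>
    (Submodule.fg_iff_finiteDimensional _).2 ((W i).discrete N)
  choose T hT using hfin
  have hT' : (correlator W '' {w | ∀ i, w i ∈ T i}).Finite := by
    refine Set.Finite.image _ ?_
    have := Set.Finite.pi fun i => (T i).finite_toSet
    simpa [Set.pi] using this
  have : boundedSpan W N = Submodule.span _ (correlator W '' {w | ∀ i, w i ∈ T i}) := by
    refine le_antisymm (Submodule.span_le.2 ?_) (Submodule.span_mono (Set.image_mono ?_))
    · rintro _ ⟨w, hw, rfl⟩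
      refine (correlator W).apply_mem_of_mem_span (Submodule.toComplexSubspace
        (Submodule.span _ (correlator W '' {w | ∀ i, w i ∈ T i})))
        (fun i => (T i : Set (W i).carrier)) (fun w hw => ?_) w fun i => ?_
      · exact Submodule.subset_span ⟨w, hw, rfl⟩
      · rw [hT]; exact hw i
    · intro w hw i
      rw [← hT]
      exact Submodule.subset_span (hw i)
  rw [this]
  exact Submodule.fg_span hT'

theorem exists_correlator_mem_boundedSpan (hW : ∀ i, (W i).IsC₁Cofinite) :
    ∃ N : ℝ, ∀ w, correlator W w ∈ boundedSpan W N := by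
  choose N' hN' using fun i => (hW i).exists_weight_bound
  choose b hb using fun i => (W i).exists_grade_eq_bot
  obtain ⟨N, hN⟩ := (Set.finite_range N').bddAbove
  refine ⟨N, ?_⟩
  -- The weights are real, but each reduction lowers the total by at least 1, so induction on a
  -- natural bound n above the minimal total ∑ bᵢ suffices. For n = 0 some weight lies below its
  -- bound, so that vector is zero.
  have key : ∀ (n : ℕ) (w : ∀ i, (W i).carrier) (r : Fin (p + 2) → ℝ),
      (∀ i, w i ∈ (W i).grade (r i)) → ∑ i, r i < ∑ i, b i + n →
      correlator W w ∈ boundedSpan W N := by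
    intro n
    induction n with
    | zero =>
      intro w r hw hr
      rw [Nat.cast_zero, add_zero] at hr
      obtain ⟨i, -, hi⟩ := Finset.exists_lt_of_sum_lt hr
      have h0 := hw i
      rw [hb i _ hi, Submodule.mem_bot] at h0
      rw [(correlator W).map_coord_zero i h0]
      exact zero_mem _
    | succ n ih =>
      intro w r hw hr
      by_cases hle : ∀ i, r i ≤ N
      · exact Submodule.subset_span ⟨w, fun i =>
          (le_iSup (fun t : Set.Iic N => (W i).grade t) ⟨r i, hle i⟩) (hw i), rfl⟩
      · push Not at hle
        obtain ⟨i, hi⟩ := hle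
        have hx := hN' i (r i) (lt_of_le_of_lt (hN ⟨i, rfl⟩) hi) (hw i)
        rw [← Function.update_eq_self i w]
        generalize w i = x at hx
        induction hx using Submodule.span_induction with
        | zero => rw [MultilinearMap.map_update_zero]; exact zero_mem _
        | add x y _ _ hx hy => rw [MultilinearMap.map_update_add]; exact add_mem hx hy
        | smul c x _ hx =>
          rw [MultilinearMap.map_update_smul]
          exact (boundedSpan W N).toComplexSubspace.smul_mem c hx
        | mem x hx =>
          obtain ⟨k, hk, u, hu, w', hw', rfl⟩ := hx
          -- The reduction is applied to the vectors with w' of weight rᵢ - k in place i; the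
          -- resulting bound (∑ r - k) + k - 1 is one less than the original total.
          have h := correlator_mode_neg_one_mem_weightSpan (w := Function.update w i w')
            (r := Function.update r i (r i - k)) (fun j => by
              by_cases hj : j = i
              · subst hj; simpa using hw'
              · simpa [hj] using hw j) hk hu i
          rw [Function.update_idem, Function.update_self, Fintype.sum_update_eq] at h
          refine Submodule.span_le.2 ?_ h
          rintro _ ⟨w₁, r₁, hw₁, hr₁, rfl⟩
          refine ih w₁ r₁ hw₁ (hr₁.trans_lt ?_)
          push_cast at hr
          linarith
  intro w
  refine (correlator W).apply_mem_of_mem_span (boundedSpan W N).toComplexSubspace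
    (fun i => ⋃ r, ((W i).grade r : Set (W i).carrier)) (fun w hw => ?_) w fun i => ?_
  · choose r hr using fun i => Set.mem_iUnion.1 (hw i)
    obtain ⟨n, hn⟩ := exists_nat_gt (∑ i, r i - ∑ i, b i)
    exact key n w r hr (by linarith)
  · rw [← Submodule.iSup_eq_span, (W i).isInternal.submodule_iSup_eq_top]
    trivial

end correlator

/-! ### From Hahn series back to formal series, and the differential equation. -/

theorem HahnSeries.finite_support_coeff_mul {Γ R : Type*} [LinearOrder Γ] [AddCommGroup Γ]
    [IsOrderedAddMonoid Γ] [CommRing R] (f g : HahnSeries Γ R) (x : Γ) :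
    (Function.support fun i => f.coeff i * g.coeff (x - i)).Finite := by
  refine ((Finset.antidiagonal f.isPWO_support g.isPWO_support x).image Prod.fst).finite_toSet
    |>.subset fun i hi => ?_
  rw [Finset.mem_coe, Finset.mem_image]
  refine ⟨(i, x - i), ?_, rfl⟩
  rw [Finset.mem_antidiagonal]
  exact ⟨left_ne_zero_of_mul hi, right_ne_zero_of_mul hi, add_sub_cancel _ _⟩

theorem HahnSeries.coeff_mul_eq_finsum {Γ R : Type*} [LinearOrder Γ] [AddCommGroup Γ]
    [IsOrderedAddMonoid Γ] [CommRing R] (f g : HahnSeries Γ R) (x : Γ) :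
    (f * g).coeff x = ∑ᶠ i, f.coeff i * g.coeff (x - i) := by
  classical
  rw [HahnSeries.coeff_mul, finsum_eq_sum_of_support_subset
    (s := (Finset.antidiagonal f.isPWO_support g.isPWO_support x).image Prod.fst)]
  · rw [Finset.sum_image]
    · refine Finset.sum_congr rfl fun ij hij => ?_
      rw [Finset.mem_antidiagonal] at hij
      rw [← hij.2.2, add_sub_cancel_left]
    · intro a ha b hb hab
      rw [Finset.mem_coe, Finset.mem_antidiagonal] at ha hb
      refine Prod.ext hab (add_left_cancel (a := a.1) ?_)
      rw [ha.2.2, hab, hb.2.2]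
  · intro i hi
    rw [Finset.mem_coe, Finset.mem_image]
    refine ⟨(i, x - i), ?_, rfl⟩
    rw [Finset.mem_antidiagonal]
    exact ⟨left_ne_zero_of_mul hi, right_ne_zero_of_mul hi, add_sub_cancel _ _⟩

theorem laurentExponent_bijective {p : ℕ} :
    Function.Bijective (laurentExponent : (Fin p → ℤ) → LaurentExponent p) :=
  ⟨fun _ _ h => funext fun i => congrFun (toLex.injective h) (OrderDual.toDual i),
    fun x => ⟨fun i => ofLex x (OrderDual.toDual i), rfl⟩⟩

section equation

variable {V : Type u} [AddCommGroup V] [Module ℂ V] {𝒱 : VertexOperatorAlgebra V}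
  {p : ℕ} {W : Fin (p + 2) → DiscreteModule.{u, v} 𝒱}

/-- The matrix element of the theorem, with all vectors listed together. -/
noncomputable def fullMatrixElement (Y : IntertwiningProduct 𝒱 (W (Fin.last (p + 1))) p
    (fun i => W i.succ.castSucc) (W 0).contragredient) (w : ∀ i, (W i).carrier) :
    FormalSeries p :=
  matrixElement Y (w 0) (fun i => w i.succ.castSucc) (w (Fin.last (p + 1)))

variable (Y : IntertwiningProduct 𝒱 (W (Fin.last (p + 1))) p
    (fun i => W i.succ.castSucc) (W 0).contragredient) (w : ∀ i, (W i).carrier)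

/-- With e itself as base point, the coefficient of a product at exponent e becomes a coefficient at
0 of a product of Hahn series; letting e vary covers all complex exponents. -/
theorem fullMatrixElement_sub (e : Fin p → ℂ) (k : Fin p → ℤ) :
    (fullMatrixElement Y w fun i => e i - k i) =
      (correlator W w (Y, e)).coeff (0 - laurentExponent k) := by
  refine congrArg (fullMatrixElement Y w) (funext fun i => ?_)
  change e i - k i = e i + ((0 - k i : ℤ) : ℂ)
  push_cast
  ring

theorem multipliable_fullMatrixElement (a : CoefficientRing p) :
    FormalSeries.Multipliable a (fullMatrixElement Y w) := by
  intro e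
  have h := HahnSeries.finite_support_coeff_mul (laurentExpansion p a) (correlator W w (Y, e)) 0
  refine (h.preimage laurentExponent_bijective.1.injOn).subset fun k hk => ?_
  rw [Function.mem_support, fullMatrixElement_sub] at hk
  exact hk

theorem expansionMul_fullMatrixElement (a : CoefficientRing p) (e : Fin p → ℂ) :
    FormalSeries.expansionMul a (fullMatrixElement Y w) e =
      (laurentExpansion p a * correlator W w (Y, e)).coeff 0 := by
  rw [HahnSeries.coeff_mul_eq_finsum, FormalSeries.expansionMul]
  refine finsum_eq_of_bijective _ laurentExponent_bijective fun k => ?_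
  rw [fullMatrixElement_sub]
  rfl

theorem fullMatrixElement_eq_coeff (e : Fin p → ℂ) :
    fullMatrixElement Y w e = (correlator W w (Y, e)).coeff 0 := by
  have h := fullMatrixElement_sub Y w e 0
  simpa using h

/-- The L(-1)-derivative property in terms of exponents: for the mode index n = -e - 1 the factor -n
is e + 1, and n - 1 corresponds to the exponent e + 1. -/
theorem pderiv_fullMatrixElement (l : Fin p) (x : (W l.succ.castSucc).carrier) :
    FormalSeries.pderiv l (fullMatrixElement Y (Function.update w l.succ.castSucc x)) =
      fullMatrixElement Y (Function.update w l.succ.castSucc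
        ((W l.succ.castSucc).mode 0 𝒱.conformal x)) := by
  ext e
  have hm : ∀ (x : (W l.succ.castSucc).carrier) (e : Fin p → ℂ),
      fullMatrixElement Y (Function.update w l.succ.castSucc x) e = (W 0).evalₗ (w 0)
        (Y.mode (fun i => -e i - 1) (Function.update (fun i : Fin p => w i.succ.castSucc) l x)
          (w (Fin.last (p + 1)))) := fun x e => by
    rw [fullMatrixElement, Function.update_middle_middle,
      Function.update_of_ne (Fin.succ_castSucc_ne_last l).symm,
      Function.update_of_ne (Fin.succ_castSucc_ne_zero l).symm]
    rfl
  rw [FormalSeries.pderiv, hm, hm, Y.mode_L_neg_one, map_smul, smul_eq_mul]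
  congr 2
  · ring
  · congr 1
    ext i
    by_cases hi : i = l
    · subst hi
      simp only [exponentShift, Pi.add_apply, Pi.single_eq_same]
      push_cast
      ring
    · simp [exponentShift, hi]

theorem iterate_pderiv_fullMatrixElement (l : Fin p) (m : ℕ) :
    (FormalSeries.pderiv l)^[m] (fullMatrixElement Y w) =
      fullMatrixElement Y (Function.update w l.succ.castSucc
        (((W l.succ.castSucc).mode 0 𝒱.conformal ^ m) (w l.succ.castSucc))) := by
  induction m with
  | zero => simp
  | succ m ih =>
    rw [Function.iterate_succ_apply', ih, pderiv_fullMatrixElement, pow_succ',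
      Module.End.mul_apply]

end equation

/-- In a Noetherian module every sequence satisfies a linear relation with leading coefficient
`1`. -/
theorem exists_eq_sum_smul_of_isNoetherian {R M : Type*} [Ring R] [AddCommGroup M] [Module R M]
    [IsNoetherian R M] (y : ℕ → M) :
    ∃ m : ℕ, 0 < m ∧ ∃ c : Fin m → R, y m = ∑ i, c i • y i := by
  let chain : ℕ →o Submodule R M :=
    ⟨fun n => Submodule.span R (Set.range fun i : Fin n => y i), fun a b hab =>
      Submodule.span_mono (by rintro _ ⟨i, rfl⟩; exact ⟨Fin.castLE hab i, rfl⟩)⟩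
  obtain ⟨n, hn⟩ := monotone_stabilizes_iff_noetherian.2 ‹IsNoetherian R M› chain
  -- The chain is already constant from n on; n + 1 is taken so that the order of the relation is
  -- positive.
  refine ⟨n + 1, Nat.succ_pos n, ?_⟩
  have h1 : y (n + 1) ∈ chain (n + 2) := Submodule.subset_span ⟨Fin.last (n + 1), rfl⟩
  rw [← hn (n + 2) (by omega), hn (n + 1) (by omega)] at h1
  obtain ⟨c, hc⟩ := (Submodule.mem_span_range_iff_exists_fun R).1 h1
  exact ⟨c, hc.symm⟩

theorem theorem1p6 {V : Type u} [AddCommGroup V] [Module ℂ V] (𝒱 : VertexOperatorAlgebra V)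
    (p : ℕ) (W : Fin (p + 2) → DiscreteModule.{u, v} 𝒱) (hW : ∀ i, (W i).IsC₁Cofinite)
    (w : ∀ i, (W i).carrier) :
    ∃ (m : Fin p → ℕ) (a : Fin p → ℕ → CoefficientRing p), (∀ l, 0 < m l) ∧
      ∀ Y : IntertwiningProduct 𝒱 (W (Fin.last (p + 1))) p (fun i => W i.succ.castSucc)
          (W 0).contragredient,
        ∀ l : Fin p, FormalSeries.SatisfiesExpansion l (m l) (a l)
          (matrixElement Y (w 0) (fun i => w i.succ.castSucc) (w (Fin.last (p + 1)))) := by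
  obtain ⟨N, hN⟩ := exists_correlator_mem_boundedSpan hW
  have : IsNoetherian (laurentExpansion p).range (boundedSpan W N) :=
    isNoetherian_of_fg_of_noetherian _ (boundedSpan_fg N)
  let D : Fin p → ℕ → ∀ i, (W i).carrier := fun l n => Function.update w l.succ.castSucc
    (((W l.succ.castSucc).mode 0 𝒱.conformal ^ n) (w l.succ.castSucc))
  -- The relation is between functions on all of `CorrelatorIndex W`, so m and the coefficients are
  -- chosen before any intertwining operators.
  choose m hm c hc using fun l => exists_eq_sum_smul_of_isNoetherian
    (R := (laurentExpansion p).range) (M := boundedSpan W N) fun n => ⟨_, hN (D l n)⟩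
  choose a ha using fun l i => (c l i).2
  -- The relation expresses the top derivative through lower ones, hence the sign; its coefficients
  -- are indexed by the order m - k of the derivative. The default value is never used for 1 ≤ k ≤
  -- m.
  refine ⟨m, fun l k => if h : m l - k < m l then -a l ⟨m l - k, h⟩ else 0, hm,
    fun Y l => ⟨fun k _ => ?_, ?_⟩⟩
  · change FormalSeries.Multipliable _ ((FormalSeries.pderiv l)^[_] (fullMatrixElement Y w))
    rw [iterate_pderiv_fullMatrixElement]
    exact multipliable_fullMatrixElement Y _ _
  · change (FormalSeries.pderiv l)^[_] (fullMatrixElement Y w) + ∑ k ∈ _,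
      FormalSeries.expansionMul _ ((FormalSeries.pderiv l)^[_] (fullMatrixElement Y w)) = 0
    simp only [iterate_pderiv_fullMatrixElement]
    ext e
    rw [Pi.add_apply, Finset.sum_apply, fullMatrixElement_eq_coeff]
    simp only [expansionMul_fullMatrixElement]
    -- Evaluation at the given operators with base point e, followed by the coefficient at 0, gives
    -- the coefficient of the equation at exponent e.
    have h := congrArg (fun f => (f.1 (Y, e)).coeff 0) (hc l)
    simp only [Submodule.coe_sum, Submodule.coe_smul, Finset.sum_apply, Pi.smul_apply,
      HahnSeries.coeff_sum] at h
    rw [h]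
    have h' : ∀ i : Fin (m l), (c l i • correlator W (D l i) (Y, e)).coeff 0 =
        (laurentExpansion p (a l i) * correlator W (D l i) (Y, e)).coeff 0 := fun i => by
      rw [ha]; rfl
    simp only [h']
    let G : ℕ → ℂ := fun i => if h : i < m l then
      (laurentExpansion p (a l ⟨i, h⟩) * correlator W (D l i) (Y, e)).coeff 0 else 0
    have h₁ : ∑ i : Fin (m l), (laurentExpansion p (a l i) * correlator W (D l i) (Y, e)).coeff 0 =
        ∑ i ∈ Finset.range (m l), G i := by
      rw [← Fin.sum_univ_eq_sum_range]
      exact Finset.sum_congr rfl fun i _ => by simp only [G, i.2, dif_pos]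
    have h₂ : ∑ i ∈ Finset.range (m l), G i = ∑ k ∈ Finset.Icc 1 (m l), G (m l - k) :=
      Finset.sum_nbij' (fun i => m l - i) (fun k => m l - k)
        (fun i hi => by simp only [Finset.mem_range, Finset.mem_Icc] at *; omega)
        (fun i hi => by simp only [Finset.mem_range, Finset.mem_Icc] at *; omega)
        (fun i hi => by simp only [Finset.mem_range] at *; omega)
        (fun i hi => by simp only [Finset.mem_Icc] at *; omega)
        (fun i hi => by
          simp only [Finset.mem_range] at hi
          rw [Nat.sub_sub_self hi.le])
    rw [h₁, h₂, ← Finset.sum_add_distrib]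
    refine Finset.sum_eq_zero fun k hk => ?_
    have hlt : m l - k < m l := by
      rw [Finset.mem_Icc] at hk
      have := hm l
      omega
    simp only [G, hlt, dif_pos, map_neg]
    exact (congrArg (_ + ·) (congrArg (HahnSeries.coeff · 0) (neg_mul
      (laurentExpansion p (a l ⟨m l - k, hlt⟩)) (correlator W (D l (m l - k)) (Y, e))))).trans
      (add_neg_cancel _)
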